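/- **Setting.** Let $A:\mathbb R^d\to\mathbb R$ be $C^\infty$ and put $d\Gamma(y)=e^{2A(y)}\,dy$. Assume that the SDE $dY_t=\nabla A(Y_t)\,dt+dB_t$, with $B$ a standard $d$-dimensional Brownian motion, has for every starting point $x\in\mathbb R^d$ a (global) weak solution that is unique in law; write $\mathbb P_x$ for its law, which depends measurably on $x$, and $\mathbb P_\nu=\int\nu(dx)\,\mathbb P_x$. Assume that $Y$ is a Markov process having a transition density $p^0(t,x,y)$, $t>0$, with respect to $\Gamma$ that satisfies the BASSA conditions: $p^0\ge 0$ is continuous on $(0,\infty)\times\mathbb R^d\times\mathbb R^d$, symmetric in $(x,y)$, satisfies the Chapman–Kolmogorov equation and $\int p^0(t,x,y)\,d\Gamma(y)\le 1$, and, for every continuous $f$ vanishing at infinity, $P_tf(x)=\int p^0(t,x,y)f(y)\,d\Gamma(y)$ is continuous and vanishes at infinity for each $t>0$, and $P_tf(x)\to f(x)$ as $t\downarrow 0$ for each $x$. Let $\mu$ be a probability measure on $\mathbb R^d$ (the regeneration distribution) and let $\kappa:\mathbb R^d\to\mathbb R$ be continuous with $\kappa\ge\underline\kappa$ $\Gamma$-almost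 everywhere, for a constant $\underline\kappa>0$. Let $M>\inf_x\kappa(x)$, and put $\kappa_M=\kappa\wedge M$ and $\kappa_M^{\mathrm e}=\kappa-\kappa_M$. With $\xi\sim\mathrm{Exp}(1)$ independent of $Y$ and $\inf\varnothing=\infty$, define $$\tau_\partial=\inf\Big\{t\ge 0:\int_0^t\kappa(Y_s)\,ds\ge\xi\Big\},\qquad \tau_M^{\mathrm e}=\inf\Big\{t\ge 0:\int_0^t\kappa_M^{\mathrm e}(Y_s)\,ds\ge\xi\Big\}.$$ The Restore process with interarrival dynamics $Y$, regeneration rate $\kappa$ and regeneration distribution $\mu$, started from $\nu$, is $X_t=\sum_{i\ge 0}1_{[T_i,T_{i+1})}(t)\,Y^{(i)}_{t-T_i}$, where $(Y^{(i)},\tau^{(i)})_{i\ge 0}$ are independent, $(Y^{(0)},\tau^{(0)})$ is a copy of $(Y,\tau_\partial)$ under $\mathbb P_\nu$, the others are copies of $(Y,\tau_\partial)$ under $\mathbb P_\mu$, and $T_n=\sum_{i<n}\tau^{(i)}$. A probability measure $\pi$ is invariant if $X_0\sim\pi$ implies $X_t\sim\pi$ for all $t\ge 0$. The Restore process with rate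 $\kappa_M$ is defined in the same way, with $\kappa_M$ in place of $\kappa$. **Theorem.** The Restore processes with rates $\kappa$ and $\kappa_M$ have unique invariant probability distributions $\pi$ and $\pi_M$, respectively, and $$\|\pi_M-\pi\|_{1}\le\frac{4\int_0^\infty\mathbb P_\mu(\tau_M^{\mathrm e}\le t)\,e^{-t\underline\kappa}\,dt}{\mathbb E_\mu[\tau_\partial]},$$ where $\|\cdot\|_1$ is the total variation norm, $\|\nu\|_1=\sup\{|\nu(f)|: f\text{ measurable},\ |f|\le 1\}$. -/

import Mathlib

open MeasureTheory ProbabilityTheory Set Filter Topology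
open scoped NNReal ENNReal ZeroAtInfty

noncomputable section

namespace Restore

/-- The state space `ℝ^d` with its Euclidean norm. -/
abbrev Euc (d : ℕ) : Type := EuclideanSpace ℝ (Fin d)

variable {d : ℕ} {Ω : Type*} [mΩ : MeasurableSpace Ω]

/-! ### The interarrival diffusion -/

/-- The reference measure `dΓ(y) = exp(2 A(y)) dy`. -/
def refMeasure (A : Euc d → ℝ) : Measure (Euc d) :=
  (volume : Measure (Euc d)).withDensity fun y => ENNReal.ofReal (Real.exp (2 * A y))

/-- `B` is a standard `d`-dimensional Brownian motion with respect to the filtration `𝓕`. -/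
structure IsBrownianMotion (𝓕 : Filtration ℝ≥0 mΩ)
    (P : Measure Ω) (B : ℝ≥0 → Ω → Euc d) : Prop where
  adapted : ∀ t, Measurable[𝓕 t] (B t)
  zero : ∀ᵐ ω ∂P, B 0 ω = 0
  continuous_paths : ∀ᵐ ω ∂P, Continuous fun t => B t ω
  increment_law : ∀ s t : ℝ≥0, s ≤ t →
    P.map (fun ω => B t ω - B s ω) =
      (stdGaussian (Euc d)).map (fun z => Real.sqrt ((t : ℝ) - s) • z)
  increment_indep : ∀ s t : ℝ≥0, s ≤ t →
    Indep (MeasurableSpace.comap (fun ω => B t ω - B s ω) inferInstance) (𝓕 s) P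

/-- Under `P`, the process `Y` is a (global) weak solution of
`dY_t = ∇A(Y_t) dt + dB_t`, `Y_0 = x`, for some Brownian motion `B` on the same space. -/
def IsWeakSolution (A : Euc d → ℝ) (x : Euc d) (P : Measure Ω) (Y : ℝ≥0 → Ω → Euc d) : Prop :=
  ∃ (𝓕 : Filtration ℝ≥0 mΩ) (B : ℝ≥0 → Ω → Euc d),
    IsBrownianMotion 𝓕 P B ∧
    (∀ t, Measurable[𝓕 t] (Y t)) ∧
    (∀ᵐ ω ∂P, Continuous fun t => Y t ω) ∧
    ∀ᵐ ω ∂P, ∀ t : ℝ≥0,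
      Y t ω = x + (∫ s in (0 : ℝ)..t, gradient A (Y s.toNNReal ω)) + B t ω

/-- Uniqueness of weak solutions: any two weak solutions with the same starting point have
the same law on path space. -/
def WeakUniqueness (A : Euc d → ℝ) : Prop :=
  ∀ (x : Euc d) (Ω₁ Ω₂ : Type) [MeasurableSpace Ω₁] [MeasurableSpace Ω₂]
    (P₁ : Measure Ω₁) (P₂ : Measure Ω₂) [IsProbabilityMeasure P₁] [IsProbabilityMeasure P₂]
    (Y₁ : ℝ≥0 → Ω₁ → Euc d) (Y₂ : ℝ≥0 → Ω₂ → Euc d),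
    IsWeakSolution A x P₁ Y₁ → IsWeakSolution A x P₂ Y₂ →
      P₁.map (fun ω t => Y₁ t ω) = P₂.map (fun ω t => Y₂ t ω)

/-- The BASSA conditions (basic assumptions of stochastic spectral analysis) of
Demuth and van Casteren for a kernel `p t x y`, `t > 0`, with respect to the measure `m`:
a continuous, symmetric, sub-Markovian transition density whose semigroup has the Feller
property and is (pointwise) continuous at time `0` on the continuous functions vanishing
at infinity. -/
structure IsBASSA (m : Measure (Euc d)) (p : ℝ → Euc d → Euc d → ℝ) : Prop where
  nonneg : ∀ t, 0 < t → ∀ x y, 0 ≤ p t x y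
  continuous : ContinuousOn (fun q : ℝ × Euc d × Euc d => p q.1 q.2.1 q.2.2) (Ioi 0 ×ˢ univ)
  symmetric : ∀ t, 0 < t → ∀ x y, p t x y = p t y x
  chapman_kolmogorov : ∀ s t, 0 < s → 0 < t → ∀ x y,
    ∫⁻ z, ENNReal.ofReal (p s x z) * ENNReal.ofReal (p t z y) ∂m = ENNReal.ofReal (p (s + t) x y)
  sub_markov : ∀ t, 0 < t → ∀ x, ∫⁻ y, ENNReal.ofReal (p t x y) ∂m ≤ 1
  feller : ∀ t, 0 < t → ∀ f : C₀(Euc d, ℝ), ∃ g : C₀(Euc d, ℝ),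
    ∀ x, g x = ∫ y, p t x y * f y ∂m
  continuous_at_zero : ∀ (f : C₀(Euc d, ℝ)) (x : Euc d),
    Tendsto (fun t => ∫ y, p t x y * f y ∂m) (𝓝[>] 0) (𝓝 (f x))

/-- `Y`, under the family of laws `P x` (start at `x`), is the diffusion
`dY_t = ∇A(Y_t) dt + dB_t`; it is a Markov process with transition density `p` with respect
to `Γ`, and `p` satisfies the BASSA conditions. -/
structure IsBASSADiffusion (A : Euc d → ℝ) (p : ℝ → Euc d → Euc d → ℝ)
    (P : Kernel (Euc d) Ω) (Y : ℝ≥0 → Ω → Euc d) : Prop where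
  smooth : ContDiff ℝ (⊤ : ℕ∞) A
  weak_uniqueness : WeakUniqueness A
  measurable : ∀ t, Measurable (Y t)
  continuous_paths : ∀ ω, Continuous fun t => Y t ω
  weak_solution : ∀ x, IsWeakSolution A x (P x) Y
  /-- For `G` in the past `σ(Y_u, u ≤ s)`:
  `P_x(G, Y_{s+t} ∈ B) = E_x[1_G ∫_B p(t, Y_s, y) dΓ(y)]`. -/
  transition : ∀ (x : Euc d) (s t : ℝ≥0), 0 < t → ∀ (G : Set Ω) (B : Set (Euc d)),
    MeasurableSet[⨆ u : Iic s, MeasurableSpace.comap (Y u) inferInstance] G → MeasurableSet B →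
      P x (G ∩ Y (s + t) ⁻¹' B) =
        ∫⁻ ω in G, ∫⁻ y in B, ENNReal.ofReal (p t (Y s ω) y) ∂(refMeasure A) ∂(P x)
  bassa : IsBASSA (refMeasure A) p

/-! ### Lifetimes and the Restore process -/

/-- The first arrival time `inf {t ≥ 0 : ∫₀ᵗ κ(Y_s) ds ≥ ξ}` (with `inf ∅ = ∞`) at rate `κ`,
where `z = (ω, ξ)` consists of the randomness `ω` of `Y` and of the level `ξ`. -/
def arrivalTime (Y : ℝ≥0 → Ω → Euc d) (κ : Euc d → ℝ) (z : Ω × ℝ) : ℝ≥0∞ :=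
  ⨅ (t : ℝ≥0) (_ : z.2 ≤ ∫ s in (0 : ℝ)..t, κ (Y s.toNNReal z.1)), (t : ℝ≥0∞)

/-- The joint law of `(ω, ξ)` with `Y_0 ∼ ν` and `ξ ∼ Exp(1)` independent of `Y`. -/
def cycleLaw (P : Kernel (Euc d) Ω) (ν : Measure (Euc d)) : Measure (Ω × ℝ) :=
  (ν.bind P).prod (expMeasure 1)

/-- The regeneration times `T_n = τ⁽⁰⁾ + ⋯ + τ⁽ⁿ⁻¹⁾`. -/
def regenTime (Y : ℝ≥0 → Ω → Euc d) (κ : Euc d → ℝ) (n : ℕ) (w : ℕ → Ω × ℝ) : ℝ≥0∞ :=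
  ∑ i ∈ Finset.range n, arrivalTime Y κ (w i)

open Classical in
/-- The Restore process `X_t = ∑ᵢ 1_{[T_i, T_{i+1})}(t) Y⁽ⁱ⁾_{t - T_i}`. -/
def restoreProcess (Y : ℝ≥0 → Ω → Euc d) (κ : Euc d → ℝ) (t : ℝ≥0) (w : ℕ → Ω × ℝ) : Euc d :=
  ∑' i : ℕ, if regenTime Y κ i w ≤ t ∧ (t : ℝ≥0∞) < regenTime Y κ (i + 1) w then
    Y (t - (regenTime Y κ i w).toNNReal) (w i).1 else 0

/-- The law of the independent cycles when `X_0 ∼ ν` and the regeneration distribution is `μ`: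
the cycle `0` starts from `ν`, all the others start from `μ`. -/
def restoreLaw (P : Kernel (Euc d) Ω) (μ ν : Measure (Euc d)) : Measure (ℕ → Ω × ℝ) :=
  Measure.infinitePi fun i => cycleLaw P (if i = 0 then ν else μ)

/-- `π` is an invariant distribution of the Restore process with interarrival dynamics `Y`,
regeneration rate `κ` and regeneration distribution `μ`: if `X_0 ∼ π` then `X_t ∼ π` for
all `t ≥ 0`. -/
def IsInvariant (P : Kernel (Euc d) Ω) (Y : ℝ≥0 → Ω → Euc d) (κ : Euc d → ℝ)
    (μ π : Measure (Euc d)) : Prop :=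
  ∀ t : ℝ≥0, (restoreLaw P μ π).map (restoreProcess Y κ t) = π

/-- The truncated rate `κ_M = κ ∧ M`. -/
def truncRate (κ : Euc d → ℝ) (M : ℝ) : Euc d → ℝ := fun x => min (κ x) M

/-- The excess rate `κ - κ_M`. -/
def excessRate (κ : Euc d → ℝ) (M : ℝ) : Euc d → ℝ := fun x => κ x - truncRate κ M x

/-- The total variation norm
`‖ν₁ - ν₂‖ = sup {|ν₁(f) - ν₂(f)| : f measurable, ‖f‖_∞ ≤ 1}`. -/
def tvNorm (ν₁ ν₂ : Measure (Euc d)) : ℝ≥0∞ :=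
  ⨆ (f : Euc d → ℝ) (_ : Measurable f) (_ : ∀ x, |f x| ≤ 1),
    ENNReal.ofReal |(∫ x, f x ∂ν₁) - ∫ x, f x ∂ν₂|

end Restore

end

namespace Restore

variable {d : ℕ} {Ω : Type*}

/-! ### Path functionals -/

/-! Regeneration makes $X$ a renewal process of cycles. A rate bounded below by $a>0$ gives
lifetimes an exponential tail, uniformly over starting laws, so mean lifetimes are finite, and the
invariant law is the occupation measure of one $\mu$-cycle divided by its mean length.

Existence: put $S_f(s)=\mathbb E_\mu[f(Y_s);s<\tau]$ and $m(s)=\mathbb E_\mu f(X_s)$. Started from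
the normalised occupation measure, the part of $\mathbb E f(X_t)$ without regeneration is
proportional to $\int_t^\infty S_f$, by the semigroup property of the killed process
(`IsMarkovFamily.killed_killed`). The first lifetime has density proportional to $S_1$, so the
regenerated part is proportional to $\int_0^t S_1(s)m(t-s)\,ds$. The integrated renewal equation
(`lintegral_killedMean_eq`) identifies this integral with $\int_0^t S_f$, and the two parts add up
to $\int_0^\infty S_f$.

Uniqueness: if $\pi$ is invariant, then $T\pi(B)$ and $\mathbb E_\mu\int_0^T 1_B(X_r)\,dr$ differ by
at most $\mathbb E_\pi[\tau]<\infty$. Two invariant laws are therefore compared through the same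
quantity; divide by $T$ and let $T\to\infty$ (`IsInvariant.measure_le`).

Bound: lowering the rate enlarges the occupation measure from $G$ to $H$. Normalising costs at most
$2(H-G)(\mathbb R^d)/G(\mathbb R^d)$ in total variation (`tvNorm_normalize_le`), and the mass
difference is $\int_0^\infty\mathbb E_\mu[e^{-\int_0^t\kappa_M}(1-e^{-\int_0^t\kappa_M^{\mathrm
e}})]\,dt$, which is at most the integral in the theorem (`lintegral_arrivalTime_le_add`). This
proves the estimate with 2 in place of 4. -/

theorem measurable_uncurry_path {mΩ : MeasurableSpace Ω} {Y : ℝ≥0 → Ω → Euc d}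
    (hm : ∀ t, Measurable (Y t)) (hc : ∀ ω, Continuous fun t => Y t ω) :
    Measurable fun q : ℝ≥0 × Ω => Y q.1 q.2 :=
  measurable_uncurry_of_continuous_of_measurable (u := Y) hc hm

/-- The accumulated rate `∫₀ᵗ κ(Y_s) ds`. -/
noncomputable def cumRate (Y : ℝ≥0 → Ω → Euc d) (κ : Euc d → ℝ) (t : ℝ≥0) (ω : Ω) : ℝ :=
  ∫ s in (0 : ℝ)..t, κ (Y s.toNNReal ω)

section cumRate

variable {Y : ℝ≥0 → Ω → Euc d} {κ : Euc d → ℝ}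

theorem continuous_rate_path (hc : ∀ ω, Continuous fun t => Y t ω) (hκ : Continuous κ) (ω : Ω) :
    Continuous fun s : ℝ => κ (Y s.toNNReal ω) :=
  hκ.comp ((hc ω).comp continuous_real_toNNReal)

theorem continuous_cumRate (hc : ∀ ω, Continuous fun t => Y t ω) (hκ : Continuous κ) (ω : Ω) :
    Continuous fun t => cumRate Y κ t ω :=
  (intervalIntegral.continuous_primitive
    (fun a b => (continuous_rate_path hc hκ ω).intervalIntegrable a b) 0).comp
    NNReal.continuous_coe

@[simp] theorem cumRate_zero (Y : ℝ≥0 → Ω → Euc d) (κ : Euc d → ℝ) (ω : Ω) :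
    cumRate Y κ 0 ω = 0 := by
  simp [cumRate]

theorem measurable_cumRate {mΩ : MeasurableSpace Ω} (hm : ∀ t, Measurable (Y t))
    (hc : ∀ ω, Continuous fun t => Y t ω) (hκ : Continuous κ) (t : ℝ≥0) :
    Measurable (cumRate Y κ t) := by
  have h : Measurable fun q : Ω × ℝ => κ (Y q.2.toNNReal q.1) :=
    hκ.measurable.comp ((measurable_uncurry_path hm hc).comp
      ((measurable_snd.real_toNNReal).prodMk measurable_fst))
  have h2 : cumRate Y κ t = fun ω => ∫ s in Ioc (0 : ℝ) t, κ (Y s.toNNReal ω) := by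
    ext ω
    exact intervalIntegral.integral_of_le t.2
  rw [h2]
  exact (h.stronglyMeasurable.integral_prod_right
    (ν := volume.restrict (Ioc (0 : ℝ) t))).measurable

theorem measurable_uncurry_cumRate {mΩ : MeasurableSpace Ω} (hm : ∀ t, Measurable (Y t))
    (hc : ∀ ω, Continuous fun t => Y t ω) (hκ : Continuous κ) :
    Measurable fun q : ℝ≥0 × Ω => cumRate Y κ q.1 q.2 :=
  measurable_uncurry_of_continuous_of_measurable (u := cumRate Y κ)
    (continuous_cumRate hc hκ) (measurable_cumRate hm hc hκ)

theorem monotone_cumRate (hc : ∀ ω, Continuous fun t => Y t ω) (hκ : Continuous κ)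
    (h0 : ∀ x, 0 ≤ κ x) (ω : Ω) : Monotone fun t => cumRate Y κ t ω := by
  intro s t hst
  have hi := fun a b => (continuous_rate_path hc hκ ω).intervalIntegrable (μ := volume) a b
  have := intervalIntegral.integral_add_adjacent_intervals (hi 0 s) (hi s t)
  have h2 : 0 ≤ ∫ u in (s : ℝ)..t, κ (Y u.toNNReal ω) :=
    intervalIntegral.integral_nonneg (NNReal.coe_le_coe.2 hst) fun _ _ => h0 _
  simp only [cumRate]
  linarith

theorem cumRate_nonneg (h0 : ∀ x, 0 ≤ κ x) (t : ℝ≥0) (ω : Ω) : 0 ≤ cumRate Y κ t ω :=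
  intervalIntegral.integral_nonneg t.2 fun _ _ => h0 _

theorem mul_le_cumRate (hc : ∀ ω, Continuous fun t => Y t ω) (hκ : Continuous κ) {a : ℝ}
    (h : ∀ x, a ≤ κ x) (t : ℝ≥0) (ω : Ω) : t * a ≤ cumRate Y κ t ω := by
  have := intervalIntegral.integral_mono_on (μ := volume) (a := 0) (b := (t : ℝ)) (f := fun _ => a)
    (g := fun s => κ (Y s.toNNReal ω)) t.2
    (continuous_const.intervalIntegrable _ _)
    ((continuous_rate_path hc hκ ω).intervalIntegrable _ _) fun _ _ => h _
  simpa [cumRate] using this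

theorem cumRate_add (hc : ∀ ω, Continuous fun t => Y t ω) {κ₁ κ₂ : Euc d → ℝ}
    (h₁ : Continuous κ₁) (h₂ : Continuous κ₂) (t : ℝ≥0) (ω : Ω) :
    cumRate Y (fun x => κ₁ x + κ₂ x) t ω = cumRate Y κ₁ t ω + cumRate Y κ₂ t ω :=
  intervalIntegral.integral_add ((continuous_rate_path hc h₁ ω).intervalIntegrable _ _)
    ((continuous_rate_path hc h₂ ω).intervalIntegrable _ _)

theorem arrivalTime_le_iff (hc : ∀ ω, Continuous fun t => Y t ω) (hκ : Continuous κ)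
    (h0 : ∀ x, 0 ≤ κ x) (z : Ω × ℝ) (t : ℝ≥0) :
    arrivalTime Y κ z ≤ t ↔ z.2 ≤ cumRate Y κ t z.1 := by
  refine ⟨fun h => ?_, fun h => iInf₂_le (f := fun (t : ℝ≥0) _ => (t : ℝ≥0∞)) t h⟩
  by_contra! hlt
  -- By continuity the level is still not reached at some $u>t$; monotonicity then makes $u$ a lower
  -- bound for all admissible times.
  have hev : ∀ᶠ u in 𝓝[>] t, cumRate Y κ u z.1 < z.2 :=
    (((continuous_cumRate hc hκ z.1).tendsto t).eventually_lt_const hlt).filter_mono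
      nhdsWithin_le_nhds
  obtain ⟨u, hu, htu⟩ := (hev.and self_mem_nhdsWithin).exists
  have hle : (u : ℝ≥0∞) ≤ arrivalTime Y κ z := by
    refine le_iInf₂ fun r hr => ?_
    rw [ENNReal.coe_le_coe]
    by_contra! hru
    exact absurd (hr.trans (monotone_cumRate hc hκ h0 z.1 hru.le)) (not_le.2 hu)
  exact absurd (ENNReal.coe_le_coe.1 (hle.trans h)) (not_le.2 htu)

theorem lt_arrivalTime_iff (hc : ∀ ω, Continuous fun t => Y t ω) (hκ : Continuous κ)
    (h0 : ∀ x, 0 ≤ κ x) (z : Ω × ℝ) (t : ℝ≥0) :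
    t < arrivalTime Y κ z ↔ cumRate Y κ t z.1 < z.2 := by
  rw [← not_le, arrivalTime_le_iff hc hκ h0, not_le]

theorem measurable_arrivalTime {mΩ : MeasurableSpace Ω} (hm : ∀ t, Measurable (Y t))
    (hc : ∀ ω, Continuous fun t => Y t ω) (hκ : Continuous κ) (h0 : ∀ x, 0 ≤ κ x) :
    Measurable (arrivalTime Y κ) := by
  refine measurable_of_Iic fun a => ?_
  induction a with
  | top => simp
  | coe t =>
    have : arrivalTime Y κ ⁻¹' Iic (t : ℝ≥0∞) = {z | z.2 ≤ cumRate Y κ t z.1} := by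
      ext z
      exact arrivalTime_le_iff hc hκ h0 z t
    rw [this]
    exact measurableSet_le measurable_snd ((measurable_cumRate hm hc hκ t).comp measurable_fst)

theorem arrivalTime_ne_top (hc : ∀ ω, Continuous fun t => Y t ω) (hκ : Continuous κ) {a : ℝ}
    (ha : 0 < a) (h : ∀ x, a ≤ κ x) (z : Ω × ℝ) : arrivalTime Y κ z ≠ ∞ := by
  -- The accumulated rate is at least $ta$, so the level $\xi$ is reached by time $\xi/a$, for every
  -- path and every $\xi$; a negative level is reached at time 0.
  have h1 : arrivalTime Y κ z ≤ (z.2 / a).toNNReal := by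
    rw [arrivalTime_le_iff hc hκ fun x => ha.le.trans (h x)]
    refine le_trans ?_ (mul_le_cumRate hc hκ h _ _)
    calc z.2 = z.2 / a * a := by field_simp
      _ ≤ _ := by gcongr; exact Real.le_coe_toNNReal _
  exact ne_top_of_le_ne_top ENNReal.coe_ne_top h1

end cumRate

/-! ### The exponential clock -/

instance : IsProbabilityMeasure (expMeasure 1) := isProbabilityMeasure_expMeasure one_pos

theorem expMeasure_one_Iic {a : ℝ} (ha : 0 ≤ a) :
    expMeasure 1 (Iic a) = ENNReal.ofReal (1 - Real.exp (-a)) := by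
  rw [← ofReal_cdf, cdf_expMeasure_eq one_pos, if_pos ha, one_mul]

theorem expMeasure_one_Ioi {a : ℝ} (ha : 0 ≤ a) :
    expMeasure 1 (Ioi a) = ENNReal.ofReal (Real.exp (-a)) := by
  rw [← compl_Iic, prob_compl_eq_one_sub measurableSet_Iic, expMeasure_one_Iic ha,
    ← ENNReal.ofReal_one, ← ENNReal.ofReal_sub _ (by simpa using ha)]
  simp

/-! ### Feynman–Kac representation of survival -/

section cycleLaw

variable [MeasurableSpace Ω] {Y : ℝ≥0 → Ω → Euc d} {κ : Euc d → ℝ} (P : Kernel (Euc d) Ω)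

instance [IsMarkovKernel P] (ν : Measure (Euc d)) [IsProbabilityMeasure ν] :
    IsProbabilityMeasure (cycleLaw P ν) := by
  unfold cycleLaw
  infer_instance

theorem lintegral_cycleLaw (ν : Measure (Euc d)) {F : Ω × ℝ → ℝ≥0∞} (hF : Measurable F) :
    ∫⁻ z, F z ∂(cycleLaw P ν) = ∫⁻ x, ∫⁻ ω, ∫⁻ ξ, F (ω, ξ) ∂(expMeasure 1) ∂(P x) ∂ν := by
  unfold cycleLaw
  rw [lintegral_prod _ hF.aemeasurable,
    Measure.lintegral_bind P.measurable.aemeasurable hF.lintegral_prod_right'.aemeasurable]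

/-- The semigroup of the process killed at rate `κ`, by the Feynman-Kac formula. -/
noncomputable def killed (Y : ℝ≥0 → Ω → Euc d) (κ : Euc d → ℝ) (t : ℝ≥0) (f : Euc d → ℝ≥0∞)
    (x : Euc d) : ℝ≥0∞ :=
  ∫⁻ ω, ENNReal.ofReal (Real.exp (-cumRate Y κ t ω)) * f (Y t ω) ∂(P x)

theorem measurable_killed_integrand (hm : ∀ t, Measurable (Y t))
    (hc : ∀ ω, Continuous fun t => Y t ω) (hκ : Continuous κ) {f : Euc d → ℝ≥0∞}
    (hf : Measurable f) : Measurable fun q : ℝ≥0 × Ω =>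
      ENNReal.ofReal (Real.exp (-cumRate Y κ q.1 q.2)) * f (Y q.1 q.2) :=
  (measurable_uncurry_cumRate hm hc hκ).neg.exp.ennreal_ofReal.mul
    (hf.comp (measurable_uncurry_path hm hc))

theorem measurable_uncurry_killed [IsMarkovKernel P] (hm : ∀ t, Measurable (Y t))
    (hc : ∀ ω, Continuous fun t => Y t ω) (hκ : Continuous κ) {f : Euc d → ℝ≥0∞}
    (hf : Measurable f) : Measurable fun q : ℝ≥0 × Euc d => killed P Y κ q.1 f q.2 := by
  have h := measurable_killed_integrand hm hc hκ hf
  have hp : Measurable fun r : (ℝ≥0 × Euc d) × Ω => (r.1.1, r.2) := by fun_prop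
  exact Measurable.lintegral_kernel_prod_right' (κ := P.comap Prod.snd measurable_snd) (h.comp hp)

theorem measurable_killed [IsMarkovKernel P] (hm : ∀ t, Measurable (Y t))
    (hc : ∀ ω, Continuous fun t => Y t ω) (hκ : Continuous κ) {f : Euc d → ℝ≥0∞}
    (hf : Measurable f) (t : ℝ≥0) : Measurable (killed P Y κ t f) :=
  (measurable_uncurry_killed P hm hc hκ hf).comp measurable_prodMk_left

theorem measurable_survival (hm : ∀ t, Measurable (Y t)) (hc : ∀ ω, Continuous fun t => Y t ω)
    (hκ : Continuous κ) (h0 : ∀ x, 0 ≤ κ x) (t : ℝ≥0) :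
    MeasurableSet {z : Ω × ℝ | t < arrivalTime Y κ z} :=
  measurableSet_lt measurable_const (measurable_arrivalTime hm hc hκ h0)

/-- For a fixed path, survival past $t$ means $\xi>\int_0^t\kappa(Y_s)\,ds$. Integrating out the
independent exponential level turns this event into the weight $\exp(-\int_0^t\kappa(Y_s)\,ds)$. -/
theorem setLIntegral_cycleLaw_survival (hm : ∀ t, Measurable (Y t))
    (hc : ∀ ω, Continuous fun t => Y t ω) (hκ : Continuous κ) (h0 : ∀ x, 0 ≤ κ x)
    {f : Euc d → ℝ≥0∞} (hf : Measurable f) (t : ℝ≥0) (ν : Measure (Euc d)) :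
    ∫⁻ z in {z | t < arrivalTime Y κ z}, f (Y t z.1) ∂(cycleLaw P ν) =
      ∫⁻ x, killed P Y κ t f x ∂ν := by
  have hS := measurable_survival hm hc hκ h0 t
  have hfY : Measurable fun z : Ω × ℝ => f (Y t z.1) := hf.comp ((hm t).comp measurable_fst)
  rw [← lintegral_indicator hS, lintegral_cycleLaw P ν (hfY.indicator hS)]
  refine lintegral_congr fun x => lintegral_congr fun ω => ?_
  have : ∀ ξ, {z | t < arrivalTime Y κ z}.indicator (fun z => f (Y t z.1)) (ω, ξ) =
      (Ioi (cumRate Y κ t ω)).indicator (fun _ => f (Y t ω)) ξ := by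
    intro ξ
    simp only [indicator, mem_ofPred_eq, lt_arrivalTime_iff hc hκ h0, mem_Ioi]
  simp_rw [this]
  rw [lintegral_indicator_const measurableSet_Ioi, expMeasure_one_Ioi (cumRate_nonneg h0 t ω),
    mul_comm]

theorem cycleLaw_survival (hm : ∀ t, Measurable (Y t))
    (hc : ∀ ω, Continuous fun t => Y t ω) (hκ : Continuous κ) (h0 : ∀ x, 0 ≤ κ x)
    (t : ℝ≥0) (ν : Measure (Euc d)) :
    cycleLaw P ν {z | t < arrivalTime Y κ z} = ∫⁻ x, killed P Y κ t 1 x ∂ν := by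
  rw [← setLIntegral_cycleLaw_survival P hm hc hκ h0 measurable_one]
  simp

end cycleLaw

/-! ### Riemann sums -/

theorem tendsto_riemann_sum {φ : ℝ → ℝ} (hφ : Continuous φ) (a : ℝ) {t : ℝ} (ht : 0 ≤ t) :
    Tendsto (fun n : ℕ => ∑ i ∈ Finset.range (n + 1), t / (n + 1) * φ (a + i * (t / (n + 1))))
      atTop (𝓝 (∫ u in a..(a + t), φ u)) := by
  rw [Metric.tendsto_atTop]
  intro ε hε
  have huc := (isCompact_Icc (a := a) (b := a + t)).uniformContinuousOn_of_continuous
    hφ.continuousOn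
  -- The tolerance $\varepsilon/(t+1)$ gives total error at most $\varepsilon t/(t+1)$, strictly
  -- below $\varepsilon$ even for $t=0$.
  obtain ⟨δ, hδ, hφδ⟩ := Metric.uniformContinuousOn_iff.1 huc (ε / (t + 1)) (by positivity)
  obtain ⟨N, hN⟩ := exists_nat_gt (t / δ)
  refine ⟨N, fun n hn => ?_⟩
  have hn0 : (0 : ℝ) < n + 1 := by positivity
  set h : ℝ := t / (n + 1) with hh
  have hh0 : 0 ≤ h := by positivity
  have hnh : (n + 1 : ℝ) * h = t := by rw [hh]; field_simp
  have hhδ : h < δ := by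
    rw [hh, div_lt_iff₀ hn0]
    rw [div_lt_iff₀ hδ] at hN
    have : (N : ℝ) ≤ n := by exact_mod_cast hn
    nlinarith
  have hsum : ∫ u in a..(a + t), φ u =
      ∑ i ∈ Finset.range (n + 1), ∫ u in (a + i * h)..(a + (i + 1 : ℕ) * h), φ u := by
    rw [intervalIntegral.sum_integral_adjacent_intervals (a := fun i : ℕ => a + i * h)
      fun k _ => hφ.intervalIntegrable _ _]
    push_cast
    rw [hnh]
    simp
  rw [hsum, dist_eq_norm, ← Finset.sum_sub_distrib]
  refine (norm_sum_le _ _).trans_lt ?_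
  have hbound : ∀ i ∈ Finset.range (n + 1),
      ‖h * φ (a + i * h) - ∫ u in (a + i * h)..(a + (i + 1 : ℕ) * h), φ u‖ ≤
        ε / (t + 1) * h := by
    intro i hi
    have hlen : a + (i + 1 : ℕ) * h - (a + i * h) = h := by push_cast; ring
    have hle : a + i * h ≤ a + (i + 1 : ℕ) * h := by linarith
    have hi1 : ((i : ℝ) + 1) ≤ n + 1 := by
      exact_mod_cast Finset.mem_range.1 hi
    have hih : 0 ≤ i * h := by positivity
    have hit : (i + 1 : ℕ) * h ≤ t := by
      rw [← hnh]
      push_cast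
      gcongr
    have hconst : h * φ (a + i * h) =
        ∫ _ in (a + i * h)..(a + (i + 1 : ℕ) * h), φ (a + i * h) := by
      rw [intervalIntegral.integral_const, hlen, smul_eq_mul]
    rw [hconst, ← intervalIntegral.integral_sub (continuous_const.intervalIntegrable _ _)
      (hφ.intervalIntegrable _ _)]
    refine (intervalIntegral.norm_integral_le_of_norm_le_const (C := ε / (t + 1)) ?_).trans ?_
    · intro u hu
      rw [uIoc_of_le hle] at hu
      rw [← dist_eq_norm]
      refine (hφδ _ ⟨by linarith, by linarith⟩ _ ⟨by linarith [hu.1], by linarith [hu.2]⟩ ?_).le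
      rw [Real.dist_eq, abs_sub_lt_iff]
      constructor <;> linarith [hu.1, hu.2]
    · rw [hlen, abs_of_nonneg hh0]
  calc _ ≤ ∑ i ∈ Finset.range (n + 1), ε / (t + 1) * h := Finset.sum_le_sum hbound
    _ = ε * (t / (t + 1)) := by
      rw [Finset.sum_const, Finset.card_range, nsmul_eq_mul]
      push_cast
      rw [show ((n : ℝ) + 1) * (ε / (t + 1) * h) = ε / (t + 1) * ((n + 1) * h) by ring, hnh]
      ring
    _ < ε := by
      have : t / (t + 1) < 1 := by rw [div_lt_one (by positivity)]; linarith
      nlinarith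

/-- Exponentiating Riemann sums approximates the path weight by products of functions of the path at
finitely many times, which the simple Markov property can handle. -/
theorem tendsto_prod_exp_neg {Y : ℝ≥0 → Ω → Euc d} {κ : Euc d → ℝ} (hc : ∀ ω, Continuous fun t => Y t ω)
    (hκ : Continuous κ) (s t : ℝ≥0) (ω : Ω) :
    Tendsto (fun n : ℕ => ∏ i ∈ Finset.range (n + 1), ENNReal.ofReal
      (Real.exp (-((t / (n + 1) : ℝ≥0) * κ (Y (s + i * (t / (n + 1))) ω))))) atTop
      (𝓝 (ENNReal.ofReal (Real.exp (-(cumRate Y κ (s + t) ω - cumRate Y κ s ω))))) := by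
  have hcont := continuous_rate_path hc hκ ω
  have h := tendsto_riemann_sum hcont s t.coe_nonneg
  have hI : ∫ u in (s : ℝ)..(s + t), κ (Y u.toNNReal ω) =
      cumRate Y κ (s + t) ω - cumRate Y κ s ω := by
    rw [cumRate, cumRate, intervalIntegral.integral_interval_sub_left
      (hcont.intervalIntegrable _ _) (hcont.intervalIntegrable _ _)]
    simp
  rw [hI] at h
  refine ((ENNReal.continuous_ofReal.tendsto _).comp
    ((Real.continuous_exp.tendsto _).comp h.neg)).congr fun n => ?_
  simp only [Function.comp_apply]
  rw [← Finset.sum_neg_distrib, Real.exp_sum, ENNReal.ofReal_prod_of_nonneg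
    fun i _ => (Real.exp_pos _).le]
  refine Finset.prod_congr rfl fun i _ => ?_
  have : (s + i * (t / (n + 1)) : ℝ).toNNReal = s + i * (t / (n + 1)) := by
    rw [← Real.toNNReal_coe (r := s + i * (t / (n + 1)))]
    push_cast
    rfl
  simp only [this]
  push_cast
  rfl

/-! ### The Markov property -/

/-- The past `σ(Y_u, u ≤ s)`. -/
abbrev past (Y : ℝ≥0 → Ω → Euc d) (s : ℝ≥0) : MeasurableSpace Ω :=
  ⨆ u : Iic s, MeasurableSpace.comap (Y u) inferInstance

/-- A Markov family with continuous paths, with the simple Markov property. -/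
structure IsMarkovFamily [MeasurableSpace Ω] (P : Kernel (Euc d) Ω) (Y : ℝ≥0 → Ω → Euc d) :
    Prop where
  measurable : ∀ t, Measurable (Y t)
  continuous_paths : ∀ ω, Continuous fun t => Y t ω
  start : ∀ x, ∀ᵐ ω ∂(P x), Y 0 ω = x
  markov : ∀ (x : Euc d) (s t : ℝ≥0) (G : Set Ω) (B : Set (Euc d)),
    MeasurableSet[past Y s] G → MeasurableSet B →
      P x (G ∩ Y (s + t) ⁻¹' B) = ∫⁻ ω in G, P (Y s ω) (Y t ⁻¹' B) ∂(P x)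

section Past

variable {mΩ : MeasurableSpace Ω} {Y : ℝ≥0 → Ω → Euc d}

theorem past_le (hm : ∀ t, Measurable (Y t)) (s : ℝ≥0) : past Y s ≤ mΩ :=
  iSup_le fun u => (hm u).comap_le

theorem past_mono {s t : ℝ≥0} (hst : s ≤ t) : past Y s ≤ past Y t :=
  iSup_le fun u => le_iSup (fun u : Iic t => MeasurableSpace.comap (Y u) inferInstance)
    ⟨u, u.2.trans hst⟩

theorem measurable_past {u s : ℝ≥0} (hus : u ≤ s) : Measurable[past Y s] (Y u) :=
  Measurable.of_comap_le
    (le_iSup (fun u : Iic s => MeasurableSpace.comap (Y u) inferInstance) ⟨u, hus⟩)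

theorem measurable_past_cumRate (hc : ∀ ω, Continuous fun t => Y t ω) {κ : Euc d → ℝ}
    (hκ : Continuous κ) (s : ℝ≥0) : Measurable[past Y s] (cumRate Y κ s) := by
  -- The path stopped at $s$ is measurable with respect to the past at every time, and has the same
  -- accumulated rate up to $s$.
  have h := measurable_cumRate (mΩ := past Y s) (Y := fun u => Y (min u s))
    (fun u => measurable_past (min_le_right _ _))
    (fun ω => (hc ω).comp (continuous_id.min continuous_const)) hκ s
  convert! h using 1
  ext ω
  refine intervalIntegral.integral_congr fun u hu => ?_
  rw [uIcc_of_le s.coe_nonneg] at hu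
  simp only
  rw [min_eq_left (Real.toNNReal_le_iff_le_coe.2 hu.2)]

end Past

theorem IsBASSADiffusion.isMarkovFamily [MeasurableSpace Ω] {A : Euc d → ℝ}
    {p : ℝ → Euc d → Euc d → ℝ} {P : Kernel (Euc d) Ω} [IsMarkovKernel P]
    {Y : ℝ≥0 → Ω → Euc d} (hY : IsBASSADiffusion A p P Y) : IsMarkovFamily P Y := by
  have hstart : ∀ x, ∀ᵐ ω ∂(P x), Y 0 ω = x := by
    intro x
    obtain ⟨𝓕, B, hB, -, -, h⟩ := hY.weak_solution x
    filter_upwards [h, hB.zero] with ω h1 h2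
    simpa [h2] using h1 0
  refine ⟨hY.measurable, hY.continuous_paths, hstart, fun x s t G B hG hB => ?_⟩
  have hG' : MeasurableSet G := past_le hY.measurable s G hG
  -- The transition density only covers $t>0$; at $t=0$ the property reduces to $Y_0=y$ almost
  -- surely under $\mathbb P_y$.
  rcases eq_or_ne t 0 with rfl | ht
  · have : ∀ y, P y (Y 0 ⁻¹' B) = B.indicator 1 y := by
      intro y
      rw [← lintegral_indicator_one (hY.measurable 0 hB)]
      rw [lintegral_congr_ae (g := fun _ => B.indicator 1 y) ?_]
      · simp
      · filter_upwards [hstart y] with ω hω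
        by_cases hyB : y ∈ B
        · rw [indicator_of_mem hyB, indicator_of_mem (by rwa [mem_preimage, hω])]
          rfl
        · rw [indicator_of_notMem hyB, indicator_of_notMem (by rwa [mem_preimage, hω])]
    simp_rw [this, add_zero]
    rw [inter_comm, ← Measure.restrict_apply (hY.measurable s hB),
      ← lintegral_indicator_one (hY.measurable s hB)]
    rfl
  · have ht' : 0 < t := pos_iff_ne_zero.2 ht
    rw [hY.transition x s t ht' G B hG hB]
    refine lintegral_congr fun ω => ?_
    -- Used again from time 0, the transition formula identifies the density integral with the law
    -- of $Y_t$ under $\mathbb P_{Y_s}$.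
    have h := hY.transition (Y s ω) 0 t ht' univ B MeasurableSet.univ hB
    rw [univ_inter, zero_add, Measure.restrict_univ] at h
    rw [h]
    symm
    rw [lintegral_congr_ae (g := fun _ => ∫⁻ y in B, ENNReal.ofReal (p t (Y s ω) y)
      ∂(refMeasure A)) ?_]
    · simp
    · filter_upwards [hstart (Y s ω)] with ω' hω'
      rw [hω']

/-! ### From the simple Markov property to the killed semigroup -/

section Markov

variable [MeasurableSpace Ω] {P : Kernel (Euc d) Ω} {Y : ℝ≥0 → Ω → Euc d}

theorem IsMarkovFamily.lintegral_mul [IsMarkovKernel P] (hY : IsMarkovFamily P Y) (x : Euc d) (s t : ℝ≥0)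
    {Z : Ω → ℝ≥0∞} (hZ : Measurable[past Y s] Z) {g : Euc d → ℝ≥0∞} (hg : Measurable g) :
    ∫⁻ ω, Z ω * g (Y (s + t) ω) ∂(P x) =
      ∫⁻ ω, Z ω * ∫⁻ ω', g (Y t ω') ∂(P (Y s ω)) ∂(P x) := by
  have hle := past_le hY.measurable s
  have hZ' : Measurable Z := hZ.mono hle le_rfl
  have hmeas : ((P x).withDensity Z).map (Y (s + t)) =
      (((P x).withDensity Z).map (Y s)).bind (P.map (Y t)) := by
    ext B hB
    have hPB : Measurable fun ω => P (Y s ω) (Y t ⁻¹' B) :=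
      (P.measurable_coe (hY.measurable t hB)).comp (hY.measurable s)
    -- The Markov property equates these two measures only on the past of $s$; that suffices because
    -- $Z$ is measurable with respect to it.
    have htrim : ((P x).restrict (Y (s + t) ⁻¹' B)).trim hle =
        ((P x).withDensity fun ω => P (Y s ω) (Y t ⁻¹' B)).trim hle := by
      refine @Measure.ext _ (past Y s) _ _ fun G hG => ?_
      rw [trim_measurableSet_eq hle hG, trim_measurableSet_eq hle hG,
        Measure.restrict_apply (hle _ hG), withDensity_apply _ (hle _ hG),
        hY.markov x s t G B hG hB]
    have hPB2 : Measurable fun ω => P.map (Y t) (Y s ω) B :=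
      (Kernel.measurable_coe _ hB).comp (hY.measurable s)
    rw [Measure.map_apply (hY.measurable _) hB, withDensity_apply _ (hY.measurable _ hB),
      ← lintegral_trim hle hZ, htrim, lintegral_trim hle hZ,
      lintegral_withDensity_eq_lintegral_mul _ hPB hZ',
      Measure.bind_apply hB (Kernel.aemeasurable _), lintegral_map
        (Kernel.measurable_coe _ hB) (hY.measurable s),
      lintegral_withDensity_eq_lintegral_mul _ hZ' hPB2]
    refine lintegral_congr fun ω => ?_
    simp only [Pi.mul_apply]
    rw [Kernel.map_apply' _ (hY.measurable t) _ hB, mul_comm]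
  have hPg : Measurable fun y => ∫⁻ z, g z ∂(P.map (Y t) y) := hg.lintegral_kernel
  have hgY : Measurable fun ω => g (Y (s + t) ω) := hg.comp (hY.measurable _)
  have hPgY : Measurable fun ω => ∫⁻ z, g z ∂(P.map (Y t) (Y s ω)) := hPg.comp (hY.measurable s)
  have h := congrArg (fun ν => ∫⁻ z, g z ∂ν) hmeas
  rw [lintegral_map hg (hY.measurable _), Measure.lintegral_bind (Kernel.aemeasurable _)
    hg.aemeasurable, lintegral_map hPg (hY.measurable s),
    lintegral_withDensity_eq_lintegral_mul _ hZ' hgY,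
    lintegral_withDensity_eq_lintegral_mul _ hZ' hPgY] at h
  simp only [Pi.mul_apply] at h
  rw [h]
  refine lintegral_congr fun ω => ?_
  rw [Kernel.map_apply _ (hY.measurable t), lintegral_map hg (hY.measurable t)]

/-- The `n`-th iterate of `g ↦ e · P_h g`, applied to `f`. -/
noncomputable def weightedIter (P : Kernel (Euc d) Ω) (Y : ℝ≥0 → Ω → Euc d) (e : Euc d → ℝ≥0∞)
    (h : ℝ≥0) (f : Euc d → ℝ≥0∞) : ℕ → Euc d → ℝ≥0∞
  | 0 => f
  | n + 1 => fun y => e y * ∫⁻ ω, weightedIter P Y e h f n (Y h ω) ∂(P y)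

theorem measurable_weightedIter (hm : ∀ t, Measurable (Y t)) {e : Euc d → ℝ≥0∞}
    (he : Measurable e) (h : ℝ≥0) {f : Euc d → ℝ≥0∞} (hf : Measurable f) (n : ℕ) :
    Measurable (weightedIter P Y e h f n) := by
  induction n with
  | zero => exact hf
  | succ n ih =>
    have h2 : Measurable fun ω => weightedIter P Y e h f n (Y h ω) := ih.comp (hm h)
    exact he.mul h2.lintegral_kernel

theorem IsMarkovFamily.lintegral_mul_prod [IsMarkovKernel P] (hY : IsMarkovFamily P Y) (x : Euc d)
    {e : Euc d → ℝ≥0∞} (he : Measurable e) (h : ℝ≥0) {f : Euc d → ℝ≥0∞} (hf : Measurable f)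
    (n : ℕ) (s : ℝ≥0) {Z : Ω → ℝ≥0∞} (hZ : Measurable[past Y s] Z) :
    ∫⁻ ω, Z ω * ((∏ i ∈ Finset.range n, e (Y (s + i * h) ω)) * f (Y (s + n * h) ω)) ∂(P x) =
      ∫⁻ ω, Z ω * weightedIter P Y e h f n (Y s ω) ∂(P x) := by
  induction n generalizing s Z with
  | zero => simp [weightedIter]
  | succ n ih =>
    have hZ2 : Measurable[past Y s] fun ω => Z ω * e (Y s ω) :=
      hZ.mul (he.comp (measurable_past le_rfl))
    -- The earliest weight is absorbed into the past factor, which is why the induction generalises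
    -- over both $s$ and $Z$.
    have h1 := ih (s + h) (Z := fun ω => Z ω * e (Y s ω)) (hZ2.mono (past_mono le_self_add) le_rfl)
    rw [hY.lintegral_mul x s h hZ2 (measurable_weightedIter hY.measurable he h hf n)] at h1
    simp only [weightedIter, ← mul_assoc] at h1 ⊢
    rw [← h1]
    refine lintegral_congr fun ω => ?_
    rw [Finset.prod_range_succ']
    have hi : ∀ i : ℕ, s + h + i * h = s + (i + 1 : ℕ) * h := by
      intro i
      push_cast
      ring
    simp only [hi, Nat.cast_zero, zero_mul, add_zero]
    ring

theorem IsMarkovFamily.weightedIter_eq [IsMarkovKernel P] (hY : IsMarkovFamily P Y) (x : Euc d)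
    {e : Euc d → ℝ≥0∞} (he : Measurable e) (h : ℝ≥0) {f : Euc d → ℝ≥0∞} (hf : Measurable f)
    (n : ℕ) : weightedIter P Y e h f n x =
      ∫⁻ ω, (∏ i ∈ Finset.range n, e (Y (i * h) ω)) * f (Y (n * h) ω) ∂(P x) := by
  have h1 := hY.lintegral_mul_prod x he h hf n 0 (Z := fun _ => 1) measurable_const
  simp only [one_mul, zero_add] at h1
  rw [h1, lintegral_congr_ae (g := fun _ => weightedIter P Y e h f n x)]
  · simp
  · filter_upwards [hY.start x] with ω hω
    rw [hω]

/-- The Markov property of the killed process. -/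
theorem IsMarkovFamily.lintegral_mul_killed [IsMarkovKernel P] (hY : IsMarkovFamily P Y) (x : Euc d)
    {κ : Euc d → ℝ} (hκ : Continuous κ) (h0 : ∀ x, 0 ≤ κ x) {f : Euc d → ℝ≥0∞}
    (hf : Measurable f) (hf1 : ∀ y, f y ≤ 1) (s t : ℝ≥0) {Z : Ω → ℝ≥0∞}
    (hZ : Measurable[past Y s] Z) (hZ1 : ∀ ω, Z ω ≤ 1) :
    ∫⁻ ω, Z ω * (ENNReal.ofReal (Real.exp (-(cumRate Y κ (s + t) ω - cumRate Y κ s ω))) *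
      f (Y (s + t) ω)) ∂(P x) = ∫⁻ ω, Z ω * killed P Y κ t f (Y s ω) ∂(P x) := by
  have hc := hY.continuous_paths
  have hm := hY.measurable
  have hZ' : Measurable Z := hZ.mono (past_le hm s) le_rfl
  set e : ℕ → Euc d → ℝ≥0∞ := fun n y =>
    ENNReal.ofReal (Real.exp (-((t / (n + 1) : ℝ≥0) * κ y))) with he_def
  have he : ∀ n, Measurable (e n) := fun n =>
    ((hκ.measurable.const_mul _).neg.exp).ennreal_ofReal
  have he1 : ∀ n y, e n y ≤ 1 := fun n y => by
    refine ENNReal.ofReal_le_one.2 (Real.exp_le_one_iff.2 (neg_nonpos.2 ?_))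
    exact mul_nonneg (NNReal.coe_nonneg _) (h0 y)
  have hend : ∀ n : ℕ, ((n + 1 : ℕ) : ℝ≥0) * (t / (n + 1)) = t := fun n => by
    push_cast
    field_simp
  have hprod1 : ∀ n (r : ℕ → Euc d), ∏ i ∈ Finset.range (n + 1), e n (r i) ≤ 1 :=
    fun n r => Finset.prod_le_one' fun i _ => he1 n _
  have hD1 : ∀ n y, weightedIter P Y (e n) (t / (n + 1)) f (n + 1) y ≤ 1 := fun n y => by
    rw [hY.weightedIter_eq y (he n) _ hf]
    refine (lintegral_mono (g := 1) fun ω => ?_).trans (by simp)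
    exact mul_le_one' (hprod1 n _) (hf1 _)
  -- As the mesh shrinks, the discretely weighted iterates converge to the killed semigroup;
  -- everything is dominated by 1.
  have hD : ∀ y, Tendsto (fun n : ℕ => weightedIter P Y (e n) (t / (n + 1)) f (n + 1) y) atTop
      (𝓝 (killed P Y κ t f y)) := fun y => by
    simp_rw [hY.weightedIter_eq y (he _) _ hf, hend]
    refine tendsto_lintegral_of_dominated_convergence 1 (fun n => ?_) (fun n => ?_) (by simp) ?_
    · exact (Finset.measurable_fun_prod _ fun i _ => (he n).comp (hm _)).mul (hf.comp (hm _))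
    · exact ae_of_all _ fun ω => mul_le_one' (hprod1 n _) (hf1 _)
    · refine ae_of_all _ fun ω => ?_
      have := tendsto_prod_exp_neg hc hκ 0 t ω
      simp only [zero_add, cumRate_zero, sub_zero] at this
      exact ENNReal.Tendsto.mul_const this (.inr (ne_top_of_le_ne_top ENNReal.one_ne_top (hf1 _)))
  have hR : Tendsto (fun n : ℕ => ∫⁻ ω, Z ω *
      weightedIter P Y (e n) (t / (n + 1)) f (n + 1) (Y s ω) ∂(P x)) atTop
      (𝓝 (∫⁻ ω, Z ω * killed P Y κ t f (Y s ω) ∂(P x))) := by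
    refine tendsto_lintegral_of_dominated_convergence 1 (fun n => ?_) (fun n => ?_) (by simp) ?_
    · exact hZ'.mul ((measurable_weightedIter hm (he n) _ hf _).comp (hm s))
    · exact ae_of_all _ fun ω => mul_le_one' (hZ1 _) (hD1 n _)
    · exact ae_of_all _ fun ω => ENNReal.Tendsto.const_mul (hD _)
        (.inr (ne_top_of_le_ne_top ENNReal.one_ne_top (hZ1 _)))
  -- The discrete Markov identity makes the approximations of both sides equal for every mesh, so
  -- their limits agree.
  refine tendsto_nhds_unique ?_ hR
  simp_rw [← hY.lintegral_mul_prod x (he _) _ hf _ s hZ, hend]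
  refine tendsto_lintegral_of_dominated_convergence 1 (fun n => ?_) (fun n => ?_) (by simp) ?_
  · exact hZ'.mul ((Finset.measurable_fun_prod _ fun i _ => (he n).comp (hm _)).mul
      (hf.comp (hm _)))
  · exact ae_of_all _ fun ω => mul_le_one' (hZ1 _) (mul_le_one' (hprod1 n _) (hf1 _))
  · refine ae_of_all _ fun ω => ENNReal.Tendsto.const_mul (ENNReal.Tendsto.mul_const
      (tendsto_prod_exp_neg hc hκ s t ω) ?_) ?_
    · exact .inr (ne_top_of_le_ne_top ENNReal.one_ne_top (hf1 _))
    · exact .inr (ne_top_of_le_ne_top ENNReal.one_ne_top (hZ1 _))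

/-- This is the Markov property with $Z=\exp(-\int_0^s\kappa(Y_u)\,du)$, because accumulated rates
over consecutive intervals add. -/
theorem IsMarkovFamily.killed_killed [IsMarkovKernel P] (hY : IsMarkovFamily P Y) {κ : Euc d → ℝ}
    (hκ : Continuous κ) (h0 : ∀ x, 0 ≤ κ x) {f : Euc d → ℝ≥0∞} (hf : Measurable f)
    (hf1 : ∀ y, f y ≤ 1) (s t : ℝ≥0) (x : Euc d) :
    killed P Y κ s (killed P Y κ t f) x = killed P Y κ (s + t) f x := by
  have h := hY.lintegral_mul_killed x hκ h0 hf hf1 s t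
    (Z := fun ω => ENNReal.ofReal (Real.exp (-cumRate Y κ s ω)))
    (measurable_past_cumRate hY.continuous_paths hκ s).neg.exp.ennreal_ofReal
    fun ω => ENNReal.ofReal_le_one.2 (Real.exp_le_one_iff.2 (neg_nonpos.2 (cumRate_nonneg h0 s ω)))
  rw [killed, ← h]
  refine lintegral_congr fun ω => ?_
  rw [← mul_assoc, ← ENNReal.ofReal_mul (Real.exp_pos _).le, ← Real.exp_add]
  congr 4
  ring

end Markov

/-! ### Decomposition at the first regeneration -/

section Law

variable [MeasurableSpace Ω] (P : Kernel (Euc d) Ω) [IsMarkovKernel P]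
  (μ ν : Measure (Euc d)) [IsProbabilityMeasure μ] [IsProbabilityMeasure ν]

instance isProbabilityMeasure_cycleLaw_ite (i : ℕ) :
    IsProbabilityMeasure (cycleLaw P (if i = 0 then ν else μ)) := by
  split_ifs <;> infer_instance

instance : IsProbabilityMeasure (restoreLaw P μ ν) := by
  unfold restoreLaw
  infer_instance

/-- Prepend a first cycle to a sequence of cycles. -/
def consCycle {α : Type*} (q : α × (ℕ → α)) : ℕ → α := fun n => Nat.casesOn n q.1 q.2

theorem measurable_consCycle {α : Type*} [MeasurableSpace α] :
    Measurable (consCycle (α := α)) := by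
  refine measurable_pi_iff.2 fun n => ?_
  cases n with
  | zero => exact measurable_fst
  | succ n => exact (measurable_pi_apply n).comp measurable_snd

theorem restoreLaw_eq_map :
    restoreLaw P μ ν = ((cycleLaw P ν).prod (restoreLaw P μ μ)).map consCycle := by
  symm
  refine Measure.eq_infinitePi _ fun s t ht => ?_
  obtain ⟨N, hN⟩ := s.exists_nat_subset_range
  -- A range of length $N+1$ always contains the index 0, so the first cycle can be split off; the
  -- sets at added indices are the whole space.
  have hN' : s ⊆ Finset.range (N + 1) := hN.trans (Finset.range_mono N.le_succ)
  classical
  set t' : ℕ → Set (Ω × ℝ) := fun i => if i ∈ s then t i else univ with ht'_def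
  have ht' : ∀ i, MeasurableSet (t' i) := fun i => by
    simp only [ht'_def]
    split_ifs
    exacts [ht i, MeasurableSet.univ]
  have hset : Set.pi (s : Set ℕ) t = Set.pi (Finset.range (N + 1) : Set ℕ) t' := by
    ext w
    simp only [Set.mem_pi, Finset.mem_coe, ht'_def]
    refine ⟨fun h i _ => ?_, fun h i hi => ?_⟩
    · split_ifs with his
      exacts [h i his, mem_univ _]
    · simpa [hi] using h i (hN' hi)
  have hprod : ∏ i ∈ s, cycleLaw P (if i = 0 then ν else μ) (t i) =
      ∏ i ∈ Finset.range (N + 1), cycleLaw P (if i = 0 then ν else μ) (t' i) := by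
    rw [← Finset.prod_subset hN' fun i _ hi => by simp [ht'_def, hi]]
    exact Finset.prod_congr rfl fun i hi => by simp [ht'_def, hi]
  have hpre : consCycle ⁻¹' Set.pi (Finset.range (N + 1) : Set ℕ) t' =
      t' 0 ×ˢ Set.pi (Finset.range N : Set ℕ) fun i => t' (i + 1) := by
    ext q
    simp only [mem_preimage, Set.mem_pi, Finset.mem_coe, Finset.mem_range, mem_prod]
    refine ⟨fun h => ⟨h 0 N.succ_pos, fun i hi => h (i + 1) (by omega)⟩, fun h i hi => ?_⟩
    cases i with
    | zero => exact h.1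
    | succ i => exact h.2 i (by omega)
  rw [hset, hprod, Measure.map_apply measurable_consCycle
    (.pi (Finset.countable_toSet _) fun i _ => ht' i), hpre, Measure.prod_prod, restoreLaw,
    Measure.infinitePi_pi _ fun i _ => ht' _, Finset.prod_range_succ', mul_comm]
  simp

end Law

/-! ### Pathwise restart at the first regeneration -/

section Recursion

variable {Y : ℝ≥0 → Ω → Euc d} {κ : Euc d → ℝ}

theorem regenTime_mono (w : ℕ → Ω × ℝ) : Monotone fun n => regenTime Y κ n w :=
  fun _ _ h => Finset.sum_le_sum_of_subset (Finset.range_mono h)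

theorem eq_of_regenTime_le_lt {w : ℕ → Ω × ℝ} {t : ℝ≥0} {i j : ℕ}
    (hi : regenTime Y κ i w ≤ t ∧ (t : ℝ≥0∞) < regenTime Y κ (i + 1) w)
    (hj : regenTime Y κ j w ≤ t ∧ (t : ℝ≥0∞) < regenTime Y κ (j + 1) w) : i = j := by
  by_contra hne
  rcases lt_or_gt_of_ne hne with h | h
  · exact absurd (hi.2.trans_le (regenTime_mono w h)) (not_lt.2 hj.1)
  · exact absurd (hj.2.trans_le (regenTime_mono w h)) (not_lt.2 hi.1)

open Classical in
-- The intervals between regenerations are disjoint, so at most one summand is nonzero. Hence the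
-- process is a limit of finite sums, which yields its joint measurability.
theorem hasSum_restoreProcess (t : ℝ≥0) (w : ℕ → Ω × ℝ) :
    HasSum (fun i : ℕ => if regenTime Y κ i w ≤ t ∧ (t : ℝ≥0∞) < regenTime Y κ (i + 1) w then
      Y (t - (regenTime Y κ i w).toNNReal) (w i).1 else 0) (restoreProcess Y κ t w) := by
  refine Summable.hasSum ?_
  by_cases h : ∃ i, regenTime Y κ i w ≤ t ∧ (t : ℝ≥0∞) < regenTime Y κ (i + 1) w
  · obtain ⟨i, hi⟩ := h
    exact (hasSum_single i fun j hj => if_neg fun h => hj (eq_of_regenTime_le_lt h hi)).summable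
  · push Not at h
    convert! summable_zero with i
    exact if_neg fun hi => absurd hi.2 (not_lt.2 (h i hi.1))

theorem restoreProcess_eq {w : ℕ → Ω × ℝ} {t : ℝ≥0} {i : ℕ}
    (hi : regenTime Y κ i w ≤ t ∧ (t : ℝ≥0∞) < regenTime Y κ (i + 1) w) :
    restoreProcess Y κ t w = Y (t - (regenTime Y κ i w).toNNReal) (w i).1 := by
  rw [restoreProcess, tsum_eq_single i fun j hj => if_neg fun h => hj (eq_of_regenTime_le_lt h hi),
    if_pos hi]

theorem restoreProcess_eq_zero {w : ℕ → Ω × ℝ} {t : ℝ≥0}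
    (h : ∀ i, ¬ (regenTime Y κ i w ≤ t ∧ (t : ℝ≥0∞) < regenTime Y κ (i + 1) w)) :
    restoreProcess Y κ t w = 0 := by
  simp only [restoreProcess, if_neg (h _), tsum_zero]

theorem regenTime_consCycle (z : Ω × ℝ) (w : ℕ → Ω × ℝ) (n : ℕ) :
    regenTime Y κ (n + 1) (consCycle (z, w)) = arrivalTime Y κ z + regenTime Y κ n w := by
  rw [regenTime, Finset.sum_range_succ', add_comm]
  rfl

theorem restoreProcess_of_lt {z : Ω × ℝ} {t : ℝ≥0} (h : t < arrivalTime Y κ z)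
    (w : ℕ → Ω × ℝ) : restoreProcess Y κ t (consCycle (z, w)) = Y t z.1 := by
  rw [restoreProcess_eq (i := 0) ⟨by simp [regenTime], by simpa [regenTime, consCycle] using h⟩]
  simp [regenTime, consCycle]

/-- Dropping the first cycle shifts all regeneration times by its length. If no interval contains
$t$, both sides take the default value 0, so explosion need not be excluded. -/
theorem restoreProcess_of_le {z : Ω × ℝ} {t : ℝ≥0} (h : arrivalTime Y κ z ≤ t)
    (w : ℕ → Ω × ℝ) : restoreProcess Y κ t (consCycle (z, w)) =
      restoreProcess Y κ (t - (arrivalTime Y κ z).toNNReal) w := by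
  have hfin : arrivalTime Y κ z ≠ ∞ := ne_top_of_le_ne_top ENNReal.coe_ne_top h
  have hcan : AddLECancellable (arrivalTime Y κ z) := ENNReal.cancel_of_ne hfin
  have hcoe : ((t - (arrivalTime Y κ z).toNNReal : ℝ≥0) : ℝ≥0∞) = t - arrivalTime Y κ z := by
    rw [ENNReal.coe_sub, ENNReal.coe_toNNReal hfin]
  have hiff : ∀ i, (regenTime Y κ (i + 1) (consCycle (z, w)) ≤ t ∧
      (t : ℝ≥0∞) < regenTime Y κ (i + 1 + 1) (consCycle (z, w))) ↔
      (regenTime Y κ i w ≤ (t - (arrivalTime Y κ z).toNNReal : ℝ≥0) ∧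
      ((t - (arrivalTime Y κ z).toNNReal : ℝ≥0) : ℝ≥0∞) < regenTime Y κ (i + 1) w) := by
    intro i
    rw [hcoe, regenTime_consCycle, regenTime_consCycle, hcan.le_tsub_iff_left h,
      hcan.tsub_lt_iff_left h]
  by_cases hex : ∃ i, regenTime Y κ i w ≤ (t - (arrivalTime Y κ z).toNNReal : ℝ≥0) ∧
      ((t - (arrivalTime Y κ z).toNNReal : ℝ≥0) : ℝ≥0∞) < regenTime Y κ (i + 1) w
  · obtain ⟨i, hi⟩ := hex
    rw [restoreProcess_eq hi, restoreProcess_eq ((hiff i).2 hi), regenTime_consCycle,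
      ENNReal.toNNReal_add hfin (ne_top_of_le_ne_top ENNReal.coe_ne_top hi.1),
      tsub_add_eq_tsub_tsub]
    rfl
  · push Not at hex
    rw [restoreProcess_eq_zero, restoreProcess_eq_zero]
    · exact fun i hi => absurd hi.2 (not_lt.2 (hex i hi.1))
    · intro i hi
      cases i with
      | zero =>
        refine absurd hi.2 (not_lt.2 ?_)
        simpa [regenTime, consCycle] using h
      | succ i => exact absurd ((hiff i).1 hi).2 (not_lt.2 (hex i ((hiff i).1 hi).1))

theorem measurable_uncurry_restoreProcess [MeasurableSpace Ω] (hm : ∀ t, Measurable (Y t))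
    (hc : ∀ ω, Continuous fun t => Y t ω) (hκ : Continuous κ) (h0 : ∀ x, 0 ≤ κ x) :
    Measurable fun q : ℝ≥0 × (ℕ → Ω × ℝ) => restoreProcess Y κ q.1 q.2 := by
  classical
  have hτ := measurable_arrivalTime hm hc hκ h0
  have hT : ∀ n, Measurable fun q : ℝ≥0 × (ℕ → Ω × ℝ) => regenTime Y κ n q.2 := fun n =>
    Finset.measurable_fun_sum _ fun i _ =>
      hτ.comp ((measurable_pi_apply i).comp measurable_snd)
  have ht : Measurable fun q : ℝ≥0 × (ℕ → Ω × ℝ) => (q.1 : ℝ≥0∞) :=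
    measurable_coe_nnreal_ennreal.comp measurable_fst
  have hY := measurable_uncurry_path hm hc
  have hterm : ∀ i, Measurable fun q : ℝ≥0 × (ℕ → Ω × ℝ) =>
      if regenTime Y κ i q.2 ≤ q.1 ∧ (q.1 : ℝ≥0∞) < regenTime Y κ (i + 1) q.2 then
        Y (q.1 - (regenTime Y κ i q.2).toNNReal) (q.2 i).1 else 0 := by
    intro i
    have hp : Measurable fun q : ℝ≥0 × (ℕ → Ω × ℝ) =>
        (q.1 - (regenTime Y κ i q.2).toNNReal, (q.2 i).1) :=
      (measurable_fst.sub (hT i).ennreal_toNNReal).prodMk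
        ((measurable_pi_apply i).comp measurable_snd).fst
    exact Measurable.ite ((measurableSet_le (hT i) ht).inter (measurableSet_lt ht (hT (i + 1))))
      (hY.comp hp) measurable_const
  refine measurable_of_tendsto_metrizable (f := fun n (q : ℝ≥0 × (ℕ → Ω × ℝ)) =>
    ∑ i ∈ Finset.range n, if regenTime Y κ i q.2 ≤ q.1 ∧
      (q.1 : ℝ≥0∞) < regenTime Y κ (i + 1) q.2 then
        Y (q.1 - (regenTime Y κ i q.2).toNNReal) (q.2 i).1 else 0)
    (fun n => Finset.measurable_fun_sum _ fun i _ => hterm i) ?_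
  refine tendsto_pi_nhds.2 fun q => ?_
  convert (hasSum_restoreProcess (Y := Y) (κ := κ) q.1 q.2).tendsto_sum_nat

theorem measurable_restoreProcess [MeasurableSpace Ω] (hm : ∀ t, Measurable (Y t))
    (hc : ∀ ω, Continuous fun t => Y t ω) (hκ : Continuous κ) (h0 : ∀ x, 0 ≤ κ x) (t : ℝ≥0) :
    Measurable (restoreProcess Y κ t) := by
  have h : Measurable (Function.uncurry (restoreProcess Y κ)) :=
    measurable_uncurry_restoreProcess hm hc hκ h0
  exact h.of_uncurry_left

end Recursion

/-! ### The renewal equation -/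

section Renewal

variable [MeasurableSpace Ω] (P : Kernel (Euc d) Ω) (Y : ℝ≥0 → Ω → Euc d)
  (κ : Euc d → ℝ) (μ ν : Measure (Euc d)) (f : Euc d → ℝ≥0∞)

/-- `E_ν[f(X_t)]` for the Restore process `X` with regeneration distribution `μ`. -/
noncomputable def restoreMean (t : ℝ≥0) : ℝ≥0∞ :=
  ∫⁻ w, f (restoreProcess Y κ t w) ∂(restoreLaw P μ ν)

variable {P Y κ f} [IsMarkovKernel P] [IsProbabilityMeasure μ] [IsProbabilityMeasure ν]

theorem measurable_restoreMean (hm : ∀ t, Measurable (Y t))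
    (hc : ∀ ω, Continuous fun t => Y t ω) (hκ : Continuous κ) (h0 : ∀ x, 0 ≤ κ x)
    (hf : Measurable f) : Measurable (restoreMean P Y κ μ ν f) := by
  have h : Measurable fun q : ℝ≥0 × (ℕ → Ω × ℝ) => f (restoreProcess Y κ q.1 q.2) :=
    hf.comp (measurable_uncurry_restoreProcess hm hc hκ h0)
  exact h.lintegral_prod_right' (ν := restoreLaw P μ ν)

theorem restoreMean_le_one (hf1 : ∀ y, f y ≤ 1) (t : ℝ≥0) :
    restoreMean P Y κ μ ν f t ≤ 1 :=
  (lintegral_mono (g := 1) fun _ => hf1 _).trans (by simp)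

/-- This is the renewal equation: on survival of the first cycle the process is $Y_t$; otherwise it
restarts from $\mu$, independently of that cycle. -/
theorem restoreMean_eq (hm : ∀ t, Measurable (Y t))
    (hc : ∀ ω, Continuous fun t => Y t ω) (hκ : Continuous κ) (h0 : ∀ x, 0 ≤ κ x)
    (hf : Measurable f) (t : ℝ≥0) :
    restoreMean P Y κ μ ν f t = ∫⁻ x, killed P Y κ t f x ∂ν +
      ∫⁻ z in {z | arrivalTime Y κ z ≤ t},
        restoreMean P Y κ μ μ f (t - (arrivalTime Y κ z).toNNReal) ∂(cycleLaw P ν) := by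
  have hX : Measurable fun w : ℕ → Ω × ℝ => f (restoreProcess Y κ t w) :=
    hf.comp (measurable_restoreProcess hm hc hκ h0 t)
  have hX' : Measurable fun q : (Ω × ℝ) × (ℕ → Ω × ℝ) =>
      f (restoreProcess Y κ t (consCycle q)) := hX.comp measurable_consCycle
  rw [restoreMean, restoreLaw_eq_map, lintegral_map hX measurable_consCycle,
    lintegral_prod _ hX'.aemeasurable,
    ← lintegral_add_compl _ (measurable_survival hm hc hκ h0 t),
    ← setLIntegral_cycleLaw_survival P hm hc hκ h0 hf]
  have hcompl : {z | (t : ℝ≥0∞) < arrivalTime Y κ z}ᶜ = {z | arrivalTime Y κ z ≤ t} := by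
    ext z
    simp
  congr 1
  · refine setLIntegral_congr_fun (measurable_survival hm hc hκ h0 t) fun z hz => ?_
    simp only [restoreProcess_of_lt hz]
    simp
  · rw [hcompl]
    refine setLIntegral_congr_fun (measurableSet_le (measurable_arrivalTime hm hc hκ h0)
      measurable_const) fun z hz => ?_
    simp only [restoreProcess_of_le hz]
    rfl

end Renewal

/-! ### Mean lifetimes and the occupation measure -/

section Occupation

variable [MeasurableSpace Ω] (P : Kernel (Euc d) Ω) (Y : ℝ≥0 → Ω → Euc d)
  (κ : Euc d → ℝ) (ν : Measure (Euc d)) (f : Euc d → ℝ≥0∞)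

/-- `E_ν[f(Y_s); s < τ_∂]`. -/
noncomputable def killedMean (s : ℝ≥0) : ℝ≥0∞ := ∫⁻ x, killed P Y κ s f x ∂ν

/-- The occupation measure `B ↦ E_ν[∫₀^τ 1_B(Y_s) ds]` of a cycle. -/
noncomputable def occupation : Measure (Euc d) :=
  (((volume.restrict (Ioi (0 : ℝ))).prod (cycleLaw P ν)).restrict
    {q | (q.1.toNNReal : ℝ≥0∞) < arrivalTime Y κ q.2}).map fun q => Y q.1.toNNReal q.2.1

variable {P Y κ ν f}

theorem killedMean_mono {f g : Euc d → ℝ≥0∞} (h : ∀ y, f y ≤ g y) (s : ℝ≥0) :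
    killedMean P Y κ ν f s ≤ killedMean P Y κ ν g s :=
  lintegral_mono fun _ => lintegral_mono fun _ => mul_le_mul_right (h _) _

variable [IsMarkovKernel P]

theorem measurable_killedMean [SFinite ν] (hm : ∀ t, Measurable (Y t))
    (hc : ∀ ω, Continuous fun t => Y t ω) (hκ : Continuous κ) (hf : Measurable f) :
    Measurable (killedMean P Y κ ν f) :=
  (measurable_uncurry_killed P hm hc hκ hf).lintegral_prod_right'

theorem measurable_killedMean_toNNReal [SFinite ν] (hm : ∀ t, Measurable (Y t))
    (hc : ∀ ω, Continuous fun t => Y t ω) (hκ : Continuous κ) (hf : Measurable f) :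
    Measurable fun s : ℝ => killedMean P Y κ ν f s.toNNReal :=
  (measurable_killedMean hm hc hκ hf).comp measurable_real_toNNReal

variable [IsProbabilityMeasure ν]

theorem measurableSet_alive (hm : ∀ t, Measurable (Y t))
    (hc : ∀ ω, Continuous fun t => Y t ω) (hκ : Continuous κ) (h0 : ∀ x, 0 ≤ κ x) :
    MeasurableSet {q : ℝ × (Ω × ℝ) | (q.1.toNNReal : ℝ≥0∞) < arrivalTime Y κ q.2} :=
  measurableSet_lt (measurable_coe_nnreal_ennreal.comp measurable_fst.real_toNNReal)
    ((measurable_arrivalTime hm hc hκ h0).comp measurable_snd)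

theorem lintegral_occupation (hm : ∀ t, Measurable (Y t))
    (hc : ∀ ω, Continuous fun t => Y t ω) (hκ : Continuous κ) (h0 : ∀ x, 0 ≤ κ x)
    (hf : Measurable f) :
    ∫⁻ y, f y ∂(occupation P Y κ ν) = ∫⁻ s in Ioi (0 : ℝ), killedMean P Y κ ν f s.toNNReal := by
  have hp : Measurable fun q : ℝ × (Ω × ℝ) => (q.1.toNNReal, q.2.1) := by fun_prop
  have hY : Measurable fun q : ℝ × (Ω × ℝ) => Y q.1.toNNReal q.2.1 :=
    (measurable_uncurry_path hm hc).comp hp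
  have hS := measurableSet_alive (Y := Y) hm hc hκ h0
  have hF : Measurable fun q : ℝ × (Ω × ℝ) => f (Y q.1.toNNReal q.2.1) := hf.comp hY
  rw [occupation, lintegral_map hf hY, ← lintegral_indicator hS,
    lintegral_prod _ (hF.indicator hS).aemeasurable]
  refine lintegral_congr fun s => ?_
  rw [killedMean, ← setLIntegral_cycleLaw_survival P hm hc hκ h0 hf,
    ← lintegral_indicator (measurable_survival hm hc hκ h0 _)]
  rfl

/-- Tonelli together with $\int_0^\infty 1_{\{s<\tau\}}\,ds=\tau$. -/
theorem occupation_univ (hm : ∀ t, Measurable (Y t))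
    (hc : ∀ ω, Continuous fun t => Y t ω) (hκ : Continuous κ) (h0 : ∀ x, 0 ≤ κ x) :
    occupation P Y κ ν univ = ∫⁻ z, arrivalTime Y κ z ∂(cycleLaw P ν) := by
  have hp : Measurable fun q : ℝ × (Ω × ℝ) => (q.1.toNNReal, q.2.1) := by fun_prop
  have hY : Measurable fun q : ℝ × (Ω × ℝ) => Y q.1.toNNReal q.2.1 :=
    (measurable_uncurry_path hm hc).comp hp
  rw [occupation, Measure.map_apply hY MeasurableSet.univ, preimage_univ,
    Measure.restrict_apply_univ, Measure.prod_apply_symm (measurableSet_alive hm hc hκ h0)]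
  refine lintegral_congr fun z => ?_
  have hset : (fun s : ℝ => (s, z)) ⁻¹'
      {q : ℝ × (Ω × ℝ) | (q.1.toNNReal : ℝ≥0∞) < arrivalTime Y κ q.2} =
      {s : ℝ | ENNReal.ofReal s < arrivalTime Y κ z} := rfl
  rw [hset, Measure.restrict_apply (measurableSet_lt ENNReal.measurable_ofReal measurable_const)]
  rcases eq_or_ne (arrivalTime Y κ z) ∞ with h | h
  · simp [h]
  · have : {s : ℝ | ENNReal.ofReal s < arrivalTime Y κ z} ∩ Ioi 0 =
        Ioo 0 (arrivalTime Y κ z).toReal := by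
      ext s
      simp only [mem_inter_iff, mem_ofPred_eq, mem_Ioi, mem_Ioo]
      rw [and_comm, and_congr_right_iff]
      intro hs
      rw [ENNReal.ofReal_lt_iff_lt_toReal hs.le h]
    rw [this, Real.volume_Ioo, sub_zero, ENNReal.ofReal_toReal h]

theorem lintegral_killedMean_one (hm : ∀ t, Measurable (Y t))
    (hc : ∀ ω, Continuous fun t => Y t ω) (hκ : Continuous κ) (h0 : ∀ x, 0 ≤ κ x) :
    ∫⁻ s in Ioi (0 : ℝ), killedMean P Y κ ν 1 s.toNNReal =
      ∫⁻ z, arrivalTime Y κ z ∂(cycleLaw P ν) := by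
  rw [← occupation_univ hm hc hκ h0, ← lintegral_one, ← lintegral_occupation hm hc hκ h0
    measurable_one]
  rfl

/-- An exponential survival tail, uniform in the initial law; it makes the mean lifetime finite from
any start. -/
theorem killedMean_one_le (hc : ∀ ω, Continuous fun t => Y t ω) (hκ : Continuous κ) {a : ℝ}
    (hle : ∀ x, a ≤ κ x) (s : ℝ≥0) :
    killedMean P Y κ ν 1 s ≤ ENNReal.ofReal (Real.exp (-(s * a))) := by
  have h : ∀ x, killed P Y κ s 1 x ≤ ENNReal.ofReal (Real.exp (-(s * a))) := fun x => by
    refine (lintegral_mono (g := fun _ => ENNReal.ofReal (Real.exp (-(s * a)))) fun ω => ?_).trans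
      (by simp)
    simp only [Pi.one_apply, mul_one]
    gcongr
    exact mul_le_cumRate hc hκ hle s ω
  exact (lintegral_mono h).trans (by simp)

theorem lintegral_exp_neg_ne_top {a : ℝ} (ha : 0 < a) :
    ∫⁻ s in Ioi (0 : ℝ), ENNReal.ofReal (Real.exp (-(s * a))) ≠ ∞ := by
  have h := (exp_neg_integrableOn_Ioi 0 ha).lintegral_lt_top
  simp only [neg_mul, mul_comm a] at h
  exact h.ne

theorem lintegral_arrivalTime_ne_top (hm : ∀ t, Measurable (Y t))
    (hc : ∀ ω, Continuous fun t => Y t ω) (hκ : Continuous κ) {a : ℝ} (ha : 0 < a)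
    (hle : ∀ x, a ≤ κ x) : ∫⁻ z, arrivalTime Y κ z ∂(cycleLaw P ν) ≠ ∞ := by
  rw [← lintegral_killedMean_one hm hc hκ fun x => ha.le.trans (hle x)]
  refine ne_top_of_le_ne_top (lintegral_exp_neg_ne_top ha)
    (setLIntegral_mono (by fun_prop) fun s hs => ?_)
  have := killedMean_one_le (P := P) (ν := ν) hc hκ hle s.toNNReal
  rwa [Real.coe_toNNReal s (le_of_lt hs)] at this

/-- No rate has accumulated at time 0, so $\tau>0$ almost surely. -/
theorem lintegral_arrivalTime_ne_zero (hm : ∀ t, Measurable (Y t))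
    (hc : ∀ ω, Continuous fun t => Y t ω) (hκ : Continuous κ) (h0 : ∀ x, 0 ≤ κ x) :
    ∫⁻ z, arrivalTime Y κ z ∂(cycleLaw P ν) ≠ 0 := by
  intro h
  rw [lintegral_eq_zero_iff (measurable_arrivalTime hm hc hκ h0)] at h
  have h1 := cycleLaw_survival P hm hc hκ h0 0 ν
  have h2 : ∀ x, killed P Y κ 0 1 x = 1 := fun x => by simp [killed]
  simp only [h2, lintegral_const, measure_univ, mul_one] at h1
  have h3 : cycleLaw P ν {z | ((0 : ℝ≥0) : ℝ≥0∞) < arrivalTime Y κ z} = 0 := by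
    rw [measure_eq_zero_iff_ae_notMem]
    filter_upwards [h] with z hz
    simp [hz]
  rw [h3] at h1
  exact zero_ne_one h1

end Occupation

/-! ### The integrated renewal equation -/

section Integrated

variable [MeasurableSpace Ω] (P : Kernel (Euc d) Ω) (Y : ℝ≥0 → Ω → Euc d)
  (κ : Euc d → ℝ) (μ : Measure (Euc d)) (f : Euc d → ℝ≥0∞)

/-- `E_μ[∫₀ᵃ f(X_r) dr]` for the Restore process started from `μ`. -/
noncomputable def restoreOccupation (a : ℝ) : ℝ≥0∞ :=
  ∫⁻ r in Ioc 0 a, restoreMean P Y κ μ μ f r.toNNReal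

variable {P Y κ μ f}

theorem restoreOccupation_mono {a b : ℝ} (h : a ≤ b) :
    restoreOccupation P Y κ μ f a ≤ restoreOccupation P Y κ μ f b :=
  lintegral_mono_set (Ioc_subset_Ioc_right h)

variable [IsMarkovKernel P] [IsProbabilityMeasure μ]

theorem restoreOccupation_le (hf1 : ∀ y, f y ≤ 1) (a : ℝ) :
    restoreOccupation P Y κ μ f a ≤ ENNReal.ofReal a := by
  refine (lintegral_mono (g := 1) fun r => restoreMean_le_one μ μ hf1 _).trans ?_
  simp

/-- The integrand is at most 1, so shortening the time window by $b$ loses at most $b$. -/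
theorem restoreOccupation_le_add (hf1 : ∀ y, f y ≤ 1) (a : ℝ) {b : ℝ≥0∞} (hb : b ≠ ∞) :
    restoreOccupation P Y κ μ f a ≤ restoreOccupation P Y κ μ f (a - b.toReal) + b := by
  have hsub : Ioc 0 a ⊆ Ioc 0 (a - b.toReal) ∪ Ioc (a - b.toReal) a := fun r hr => by
    rcases le_or_gt r (a - b.toReal) with h | h
    exacts [.inl ⟨hr.1, h⟩, .inr ⟨h, hr.2⟩]
  refine (lintegral_mono_set hsub).trans ((lintegral_union_le _ _ _).trans ?_)
  refine add_le_add le_rfl ?_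
  refine (lintegral_mono (g := 1) fun r => restoreMean_le_one μ μ hf1 _).trans ?_
  simp [ENNReal.ofReal_toReal hb]

theorem lintegral_shift (m : ℝ≥0 → ℝ≥0∞) (T : ℝ) {b : ℝ≥0∞} (hb : b ≠ ∞) :
    ∫⁻ s in Ioc 0 T, {s : ℝ | b ≤ s.toNNReal}.indicator
        (fun s => m (s.toNNReal - b.toNNReal)) s =
      ∫⁻ r in Ioc 0 (T - b.toReal), m r.toNNReal := by
  have hb0 : 0 ≤ b.toReal := ENNReal.toReal_nonneg
  rw [← lintegral_indicator measurableSet_Ioc, ← lintegral_indicator measurableSet_Ioc,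
    ← lintegral_sub_right_eq_self
      (fun r => (Ioc 0 (T - b.toReal)).indicator (fun r => m r.toNNReal) r) b.toReal]
  refine lintegral_congr_ae ?_
  -- The indicator includes $s=b$ while the shifted half-open interval excludes it; this one point
  -- is null.
  have hne : ∀ᵐ s : ℝ, s ≠ b.toReal := by simp [ae_iff]
  filter_upwards [hne] with s hs
  have hiff : 0 < s → (b ≤ s.toNNReal ↔ b.toReal ≤ s) := fun hs0 => by
    rw [← ENNReal.ofReal_toReal hb]
    rw [show ((s.toNNReal : ℝ≥0) : ℝ≥0∞) = ENNReal.ofReal s from rfl,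
      ENNReal.ofReal_le_ofReal_iff hs0.le, ENNReal.toReal_ofReal hb0]
  by_cases h : s ∈ Ioc b.toReal T
  · have hs0 : 0 < s := hb0.trans_lt h.1
    rw [indicator_of_mem (show s ∈ Ioc 0 T from ⟨hs0, h.2⟩),
      indicator_of_mem (show s ∈ {s : ℝ | b ≤ s.toNNReal} from (hiff hs0).2 h.1.le),
      indicator_of_mem (show s - b.toReal ∈ Ioc 0 (T - b.toReal) from
        ⟨sub_pos.2 h.1, sub_le_sub_right h.2 _⟩)]
    congr 1
    rw [NNReal.sub_def, Real.coe_toNNReal s hs0.le]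
    rfl
  · rw [indicator_of_notMem (s := Ioc 0 (T - b.toReal))
      fun h' => h ⟨sub_pos.1 h'.1, (sub_le_sub_iff_right _).1 h'.2⟩]
    rw [indicator_apply_eq_zero]
    intro hsT
    refine indicator_of_notMem (fun hle => h ⟨?_, hsT.2⟩) _
    exact lt_of_le_of_ne ((hiff hsT.1).1 hle) hs.symm

/-- Integrate the renewal equation over $(0,T]$: after a first cycle of length $\tau$ a window of
length $T-\tau$ remains, and it is empty if $\tau\ge T$. -/
theorem lintegral_restoreMean (ν : Measure (Euc d)) [IsProbabilityMeasure ν]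
    (hm : ∀ t, Measurable (Y t)) (hc : ∀ ω, Continuous fun t => Y t ω) (hκ : Continuous κ)
    {a : ℝ} (ha : 0 < a) (hle : ∀ x, a ≤ κ x) (hf : Measurable f) (T : ℝ) :
    ∫⁻ s in Ioc 0 T, restoreMean P Y κ μ ν f s.toNNReal =
      (∫⁻ s in Ioc 0 T, killedMean P Y κ ν f s.toNNReal) +
      ∫⁻ z, restoreOccupation P Y κ μ f (T - (arrivalTime Y κ z).toReal) ∂(cycleLaw P ν) := by
  have h0 := fun x => ha.le.trans (hle x)
  have hτ := measurable_arrivalTime hm hc hκ h0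
  have hmm := measurable_restoreMean (P := P) μ μ hm hc hκ h0 hf
  have hp : Measurable fun q : ℝ × (Ω × ℝ) =>
      q.1.toNNReal - (arrivalTime Y κ q.2).toNNReal :=
    measurable_fst.real_toNNReal.sub (hτ.comp measurable_snd).ennreal_toNNReal
  have hS : MeasurableSet {q : ℝ × (Ω × ℝ) | arrivalTime Y κ q.2 ≤ q.1.toNNReal} :=
    measurableSet_le (hτ.comp measurable_snd)
      (measurable_coe_nnreal_ennreal.comp measurable_fst.real_toNNReal)
  have hF : Measurable ({q : ℝ × (Ω × ℝ) | arrivalTime Y κ q.2 ≤ q.1.toNNReal}.indicator fun q =>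
      restoreMean P Y κ μ μ f (q.1.toNNReal - (arrivalTime Y κ q.2).toNNReal)) :=
    (hmm.comp hp).indicator hS
  have heq : ∀ s : ℝ, restoreMean P Y κ μ ν f s.toNNReal = killedMean P Y κ ν f s.toNNReal +
      ∫⁻ z in {z | arrivalTime Y κ z ≤ s.toNNReal},
        restoreMean P Y κ μ μ f (s.toNNReal - (arrivalTime Y κ z).toNNReal) ∂(cycleLaw P ν) :=
    fun s => restoreMean_eq μ ν hm hc hκ h0 hf _
  simp_rw [heq]
  rw [lintegral_add_left (measurable_killedMean_toNNReal hm hc hκ hf)]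
  congr 1
  calc _ = ∫⁻ s in Ioc 0 T, ∫⁻ z, {q : ℝ × (Ω × ℝ) |
        arrivalTime Y κ q.2 ≤ q.1.toNNReal}.indicator (fun q => restoreMean P Y κ μ μ f
          (q.1.toNNReal - (arrivalTime Y κ q.2).toNNReal)) (s, z) ∂(cycleLaw P ν) := by
        refine lintegral_congr fun s => ?_
        rw [← lintegral_indicator (measurableSet_le hτ measurable_const)]
        rfl
    _ = ∫⁻ z, (∫⁻ s in Ioc 0 T, {q : ℝ × (Ω × ℝ) |
        arrivalTime Y κ q.2 ≤ q.1.toNNReal}.indicator (fun q => restoreMean P Y κ μ μ f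
          (q.1.toNNReal - (arrivalTime Y κ q.2).toNNReal)) (s, z)) ∂(cycleLaw P ν) :=
        lintegral_lintegral_swap hF.aemeasurable
    _ = _ := lintegral_congr fun z =>
        lintegral_shift _ T (arrivalTime_ne_top hc hκ ha hle z)

end Integrated

/-! ### Uniqueness of the invariant distribution -/

section Uniqueness

variable [MeasurableSpace Ω] {P : Kernel (Euc d) Ω} {Y : ℝ≥0 → Ω → Euc d}
  {κ : Euc d → ℝ} {μ π : Measure (Euc d)} 

theorem isInvariant_iff (hm : ∀ t, Measurable (Y t)) (hc : ∀ ω, Continuous fun t => Y t ω)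
    (hκ : Continuous κ) (h0 : ∀ x, 0 ≤ κ x) :
    IsInvariant P Y κ μ π ↔ ∀ B, MeasurableSet B → ∀ t,
      restoreMean P Y κ μ π (B.indicator 1) t = π B := by
  have h : ∀ t B, MeasurableSet B → restoreMean P Y κ μ π (B.indicator 1) t =
      (restoreLaw P μ π).map (restoreProcess Y κ t) B := fun t B hB => by
    rw [← lintegral_indicator_one hB, lintegral_map (measurable_one.indicator hB)
      (measurable_restoreProcess hm hc hκ h0 t)]
    rfl
  refine ⟨fun hinv B hB t => ?_, fun hB t => Measure.ext fun B hB' => ?_⟩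
  · rw [h t B hB, hinv t]
  · rw [← h t B hB', hB B hB' t]

theorem indicator_one_le (B : Set (Euc d)) (y : Euc d) : B.indicator (1 : Euc d → ℝ≥0∞) y ≤ 1 :=
  indicator_le_self' (fun _ _ => zero_le) y

variable [IsMarkovKernel P] [IsProbabilityMeasure μ] [IsProbabilityMeasure π]

/-- Invariance turns the integrated mean into $T\pi(B)$. The first cycle contributes at most its
expected length, and the later cycles at most the full window from $\mu$. -/
theorem mul_measure_le_restoreOccupation (hm : ∀ t, Measurable (Y t))
    (hc : ∀ ω, Continuous fun t => Y t ω) (hκ : Continuous κ) {a : ℝ} (ha : 0 < a)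
    (hle : ∀ x, a ≤ κ x) (hinv : IsInvariant P Y κ μ π) {B : Set (Euc d)} (hB : MeasurableSet B)
    (T : ℝ) : ENNReal.ofReal T * π B ≤ ∫⁻ z, arrivalTime Y κ z ∂(cycleLaw P π) +
      restoreOccupation P Y κ μ (B.indicator 1) T := by
  have h0 := fun x => ha.le.trans (hle x)
  have h := lintegral_restoreMean (P := P) (μ := μ) π hm hc hκ ha hle
    (measurable_one.indicator hB) T
  simp only [(isInvariant_iff hm hc hκ h0).1 hinv B hB, lintegral_const, MeasurableSet.univ,
    Measure.restrict_apply, univ_inter, Real.volume_Ioc, sub_zero] at h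
  rw [mul_comm, h, ← lintegral_killedMean_one hm hc hκ h0]
  refine add_le_add ?_ ?_
  · exact (lintegral_mono_set Ioc_subset_Ioi_self).trans
      (lintegral_mono fun s => killedMean_mono (indicator_one_le B) _)
  · refine (lintegral_mono fun z => restoreOccupation_mono (b := T) ?_).trans (by simp)
    linarith [ENNReal.toReal_nonneg (a := arrivalTime Y κ z)]

theorem restoreOccupation_le_mul_measure (hm : ∀ t, Measurable (Y t))
    (hc : ∀ ω, Continuous fun t => Y t ω) (hκ : Continuous κ) {a : ℝ} (ha : 0 < a)
    (hle : ∀ x, a ≤ κ x) (hinv : IsInvariant P Y κ μ π) {B : Set (Euc d)} (hB : MeasurableSet B)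
    (T : ℝ) : restoreOccupation P Y κ μ (B.indicator 1) T ≤
      ENNReal.ofReal T * π B + ∫⁻ z, arrivalTime Y κ z ∂(cycleLaw P π) := by
  have h0 := fun x => ha.le.trans (hle x)
  have h := lintegral_restoreMean (P := P) (μ := μ) π hm hc hκ ha hle
    (measurable_one.indicator hB) T
  simp only [(isInvariant_iff hm hc hκ h0).1 hinv B hB, lintegral_const, MeasurableSet.univ,
    Measure.restrict_apply, univ_inter, Real.volume_Ioc, sub_zero] at h
  rw [mul_comm, h]
  calc restoreOccupation P Y κ μ (B.indicator 1) T
      = ∫⁻ _, restoreOccupation P Y κ μ (B.indicator 1) T ∂(cycleLaw P π) := by simp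
    _ ≤ ∫⁻ z, (restoreOccupation P Y κ μ (B.indicator 1) (T - (arrivalTime Y κ z).toReal) +
        arrivalTime Y κ z) ∂(cycleLaw P π) := lintegral_mono fun z =>
          restoreOccupation_le_add (indicator_one_le B) T (arrivalTime_ne_top hc hκ ha hle z)
    _ = ∫⁻ z, restoreOccupation P Y κ μ (B.indicator 1) (T - (arrivalTime Y κ z).toReal)
        ∂(cycleLaw P π) + ∫⁻ z, arrivalTime Y κ z ∂(cycleLaw P π) :=
          lintegral_add_right _ (measurable_arrivalTime hm hc hκ h0)
    _ ≤ _ := add_le_add (self_le_add_left _ _) le_rfl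

theorem IsInvariant.measure_le (hm : ∀ t, Measurable (Y t))
    (hc : ∀ ω, Continuous fun t => Y t ω) (hκ : Continuous κ) {a : ℝ} (ha : 0 < a)
    (hle : ∀ x, a ≤ κ x) {π' : Measure (Euc d)} [IsProbabilityMeasure π']
    (hinv : IsInvariant P Y κ μ π) (hinv' : IsInvariant P Y κ μ π') {B : Set (Euc d)}
    (hB : MeasurableSet B) : π B ≤ π' B := by
  set K := ∫⁻ z, arrivalTime Y κ z ∂(cycleLaw P π) + ∫⁻ z, arrivalTime Y κ z ∂(cycleLaw P π')
  have hK : K ≠ ∞ := ENNReal.add_ne_top.2 ⟨lintegral_arrivalTime_ne_top hm hc hκ ha hle,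
    lintegral_arrivalTime_ne_top hm hc hκ ha hle⟩
  -- The common occupation over $T=n+1$ is eliminated, leaving an error $K$ independent of $n$,
  -- which vanishes after division.
  have h : ∀ n : ℕ, π B ≤ π' B + K / (n + 1 : ℕ) := fun n => by
    have h1 := mul_measure_le_restoreOccupation hm hc hκ ha hle hinv hB (n + 1 : ℕ)
    have h2 := restoreOccupation_le_mul_measure hm hc hκ ha hle hinv' hB (n + 1 : ℕ)
    rw [ENNReal.ofReal_natCast] at h1 h2
    have h3 : (n + 1 : ℕ) * π B ≤ (n + 1 : ℕ) * π' B + K := by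
      refine h1.trans ((add_le_add le_rfl h2).trans_eq ?_)
      ring
    have hn0 : ((n + 1 : ℕ) : ℝ≥0∞) ≠ 0 := by simp
    have hnt : ((n + 1 : ℕ) : ℝ≥0∞) ≠ ∞ := ENNReal.natCast_ne_top _
    rw [← ENNReal.mul_le_mul_iff_right hn0 hnt, mul_add, ENNReal.mul_div_cancel hn0 hnt]
    exact h3
  have hlim : Tendsto (fun n : ℕ => π' B + K / (n + 1 : ℕ)) atTop (𝓝 (π' B + K * 0)) :=
    tendsto_const_nhds.add ((ENNReal.Tendsto.const_mul ENNReal.tendsto_inv_nat_nhds_zero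
      (.inr hK)).comp (tendsto_add_atTop_nat 1))
  rw [mul_zero, add_zero] at hlim
  exact ge_of_tendsto' hlim h

theorem IsInvariant.eq (hm : ∀ t, Measurable (Y t))
    (hc : ∀ ω, Continuous fun t => Y t ω) (hκ : Continuous κ) {a : ℝ} (ha : 0 < a)
    (hle : ∀ x, a ≤ κ x) {π' : Measure (Euc d)} [IsProbabilityMeasure π']
    (hinv : IsInvariant P Y κ μ π) (hinv' : IsInvariant P Y κ μ π') : π = π' :=
  Measure.ext fun _ hB => (hinv.measure_le hm hc hκ ha hle hinv' hB).antisymm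
    (hinv'.measure_le hm hc hκ ha hle hinv hB)

end Uniqueness

/-! ### The normalised occupation measure is invariant -/

section Existence

variable [MeasurableSpace Ω] (P : Kernel (Euc d) Ω) (Y : ℝ≥0 → Ω → Euc d)
  (κ : Euc d → ℝ) (μ : Measure (Euc d))

/-- The invariant distribution `B ↦ E_μ[∫₀^τ 1_B(Y_s) ds] / E_μ[τ]`. -/
noncomputable def invariantMeasure : Measure (Euc d) :=
  (∫⁻ z, arrivalTime Y κ z ∂(cycleLaw P μ))⁻¹ • occupation P Y κ μ

variable {P Y κ μ} {f : Euc d → ℝ≥0∞} [IsMarkovKernel P] [IsProbabilityMeasure μ]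

theorem isProbabilityMeasure_invariantMeasure (hm : ∀ t, Measurable (Y t))
    (hc : ∀ ω, Continuous fun t => Y t ω) (hκ : Continuous κ) {a : ℝ} (ha : 0 < a)
    (hle : ∀ x, a ≤ κ x) : IsProbabilityMeasure (invariantMeasure P Y κ μ) := by
  have h0 := fun x => ha.le.trans (hle x)
  constructor
  rw [invariantMeasure, Measure.smul_apply, occupation_univ hm hc hκ h0, smul_eq_mul,
    ENNReal.inv_mul_cancel (lintegral_arrivalTime_ne_zero hm hc hκ h0)
      (lintegral_arrivalTime_ne_top hm hc hκ ha hle)]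

/-- Running the killed semigroup for time $t$ on the occupation measure shifts its time integral by
$t$. -/
theorem IsMarkovFamily.lintegral_killed_occupation (hY : IsMarkovFamily P Y) (hκ : Continuous κ)
    (h0 : ∀ x, 0 ≤ κ x) (hf : Measurable f) (hf1 : ∀ y, f y ≤ 1) (t : ℝ≥0) :
    ∫⁻ x, killed P Y κ t f x ∂(occupation P Y κ μ) =
      ∫⁻ s in Ioi (t : ℝ), killedMean P Y κ μ f s.toNNReal := by
  rw [lintegral_occupation hY.measurable hY.continuous_paths hκ h0
    (measurable_killed P hY.measurable hY.continuous_paths hκ hf t)]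
  have h : ∀ s : ℝ≥0, killedMean P Y κ μ (killed P Y κ t f) s = killedMean P Y κ μ f (s + t) :=
    fun s => lintegral_congr fun x => hY.killed_killed hκ h0 hf hf1 s t x
  simp_rw [h]
  rw [← lintegral_indicator measurableSet_Ioi, ← lintegral_indicator measurableSet_Ioi,
    ← lintegral_sub_right_eq_self (fun s => (Ioi (0 : ℝ)).indicator
      (fun s : ℝ => killedMean P Y κ μ f (s.toNNReal + t)) s) (t : ℝ)]
  refine lintegral_congr fun s => ?_
  by_cases hs : (t : ℝ) < s
  · rw [indicator_of_mem (show s - t ∈ Ioi 0 from sub_pos.2 hs), indicator_of_mem (mem_Ioi.2 hs)]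
    congr 1
    ext
    rw [NNReal.coe_add, Real.coe_toNNReal _ (sub_nonneg.2 hs.le),
      Real.coe_toNNReal _ (t.coe_nonneg.trans hs.le), sub_add_cancel]
  · rw [indicator_of_notMem (s := Ioi (0 : ℝ)) (fun h' => hs (sub_pos.1 h')),
      indicator_of_notMem (s := Ioi (t : ℝ)) hs]

theorem IsMarkovFamily.cycleLaw_invariantMeasure_survival (hY : IsMarkovFamily P Y)
    (hκ : Continuous κ) (h0 : ∀ x, 0 ≤ κ x) (t : ℝ≥0) :
    cycleLaw P (invariantMeasure P Y κ μ) {z | t < arrivalTime Y κ z} =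
      (∫⁻ z, arrivalTime Y κ z ∂(cycleLaw P μ))⁻¹ *
        ∫⁻ s in Ioi (t : ℝ), killedMean P Y κ μ 1 s.toNNReal := by
  rw [cycleLaw_survival P hY.measurable hY.continuous_paths hκ h0, invariantMeasure,
    lintegral_smul_measure, hY.lintegral_killed_occupation hκ h0 measurable_one fun _ => le_rfl,
    smul_eq_mul]

/-- Under the invariant distribution, the first lifetime has the stationary excess law. -/
theorem IsMarkovFamily.map_arrivalTime_invariantMeasure (hY : IsMarkovFamily P Y)
    (hκ : Continuous κ) {a : ℝ} (ha : 0 < a) (hle : ∀ x, a ≤ κ x) :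
    (cycleLaw P (invariantMeasure P Y κ μ)).map (fun z => (arrivalTime Y κ z).toReal) =
      (∫⁻ z, arrivalTime Y κ z ∂(cycleLaw P μ))⁻¹ • (volume.restrict (Ioi (0 : ℝ))).withDensity
        fun s => killedMean P Y κ μ 1 s.toNNReal := by
  have hm := hY.measurable
  have hc := hY.continuous_paths
  have h0 := fun x => ha.le.trans (hle x)
  have hτ : Measurable fun z => (arrivalTime Y κ z).toReal :=
    (measurable_arrivalTime hm hc hκ h0).ennreal_toReal
  have := isProbabilityMeasure_invariantMeasure (P := P) (μ := μ) hm hc hκ ha hle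
  have := Measure.isProbabilityMeasure_map (μ := cycleLaw P (invariantMeasure P Y κ μ))
    hτ.aemeasurable
  set c := ∫⁻ z, arrivalTime Y κ z ∂(cycleLaw P μ) with hc_def
  have hc0 : c ≠ 0 := lintegral_arrivalTime_ne_zero hm hc hκ h0
  have hct : c ≠ ∞ := lintegral_arrivalTime_ne_top hm hc hκ ha hle
  set ρ : Measure ℝ := c⁻¹ • (volume.restrict (Ioi (0 : ℝ))).withDensity
    fun s => killedMean P Y κ μ 1 s.toNNReal with hρ
  have hρ1 : IsProbabilityMeasure ρ := by
    constructor
    rw [hρ, Measure.smul_apply, withDensity_apply _ MeasurableSet.univ, Measure.restrict_univ,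
      lintegral_killedMean_one hm hc hκ h0, smul_eq_mul, ENNReal.inv_mul_cancel hc0 hct]
  -- Both sides are probability measures on $\mathbb R$, so comparing tails suffices; `toReal` is
  -- harmless because lifetimes are finite for every sample.
  refine Measure.ext_of_Iic _ _ fun t => ?_
  rcases lt_or_ge t 0 with ht | ht
  · have h1 : (fun z => (arrivalTime Y κ z).toReal) ⁻¹' Iic t = ∅ := by
      ext z
      simpa using ht.trans_le ENNReal.toReal_nonneg
    rw [Measure.map_apply hτ measurableSet_Iic, h1, hρ, Measure.smul_apply,
      withDensity_apply _ measurableSet_Iic, Measure.restrict_restrict measurableSet_Iic,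
      (show Iic t ∩ Ioi 0 = ∅ by ext s; simp; intro hs; linarith)]
    simp
  · lift t to ℝ≥0 using ht
    rw [← compl_Ioi, prob_compl_eq_one_sub measurableSet_Ioi,
      prob_compl_eq_one_sub measurableSet_Ioi]
    congr 1
    have h1 : (fun z => (arrivalTime Y κ z).toReal) ⁻¹' Ioi (t : ℝ) =
        {z | t < arrivalTime Y κ z} := by
      ext z
      have h := arrivalTime_ne_top hc hκ ha hle z
      simp only [mem_preimage, mem_Ioi, mem_ofPred_eq]
      rw [← ENNReal.ofReal_lt_iff_lt_toReal t.coe_nonneg h, ENNReal.ofReal_coe_nnreal]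
    rw [Measure.map_apply hτ measurableSet_Ioi, h1,
      hY.cycleLaw_invariantMeasure_survival hκ h0, hρ, Measure.smul_apply,
      withDensity_apply _ measurableSet_Ioi, Measure.restrict_restrict measurableSet_Ioi,
      Ioi_inter_Ioi, sup_of_le_left t.coe_nonneg, smul_eq_mul]

theorem IsMarkovFamily.setLIntegral_cycleLaw_invariantMeasure (hY : IsMarkovFamily P Y)
    (hκ : Continuous κ) {a : ℝ} (ha : 0 < a) (hle : ∀ x, a ≤ κ x) {m : ℝ≥0 → ℝ≥0∞}
    (hmm : Measurable m) (t : ℝ≥0) :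
    ∫⁻ z in {z | arrivalTime Y κ z ≤ t}, m (t - (arrivalTime Y κ z).toNNReal)
        ∂(cycleLaw P (invariantMeasure P Y κ μ)) =
      (∫⁻ z, arrivalTime Y κ z ∂(cycleLaw P μ))⁻¹ *
        ∫⁻ s in Ioc 0 (t : ℝ), killedMean P Y κ μ 1 s.toNNReal * m (t - s).toNNReal := by
  have hm := hY.measurable
  have hc := hY.continuous_paths
  have h0 := fun x => ha.le.trans (hle x)
  have hτ : Measurable fun z => (arrivalTime Y κ z).toReal :=
    (measurable_arrivalTime hm hc hκ h0).ennreal_toReal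
  have hg : Measurable fun s : ℝ => m (t - s).toNNReal :=
    hmm.comp (measurable_const.sub measurable_id).real_toNNReal
  have hS := measurable_killedMean_toNNReal (P := P) (ν := μ) hm hc hκ measurable_one
  have hset : {z | arrivalTime Y κ z ≤ t} =
      (fun z => (arrivalTime Y κ z).toReal) ⁻¹' Iic (t : ℝ) := by
    ext z
    have h := arrivalTime_ne_top hc hκ ha hle z
    simp only [mem_preimage, mem_Iic, mem_ofPred_eq]
    rw [← ENNReal.le_ofReal_iff_toReal_le h t.coe_nonneg, ENNReal.ofReal_coe_nnreal]
  have hsub : ∀ z, m (t - (arrivalTime Y κ z).toNNReal) =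
      m ((t : ℝ) - (arrivalTime Y κ z).toReal).toNNReal := fun z => by
    rw [NNReal.sub_def]
    rfl
  simp_rw [hsub, hset]
  rw [← setLIntegral_map measurableSet_Iic hg hτ, hY.map_arrivalTime_invariantMeasure hκ ha hle,
    Measure.restrict_smul, lintegral_smul_measure, smul_eq_mul,
    restrict_withDensity measurableSet_Iic, Measure.restrict_restrict measurableSet_Iic,
    inter_comm, Ioi_inter_Iic, lintegral_withDensity_eq_lintegral_mul _ hS hg]
  rfl

theorem lintegral_reflect (g h : ℝ → ℝ≥0∞) (t : ℝ) :
    ∫⁻ r in Ioc 0 t, g r * h (t - r) = ∫⁻ s in Ioc 0 t, h s * g (t - s) := by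
  -- The open interval is invariant under $s\mapsto t-s$, and the discarded endpoint is null.
  rw [← restrict_Ioo_eq_restrict_Ioc, ← lintegral_indicator measurableSet_Ioo,
    ← lintegral_indicator measurableSet_Ioo, ← lintegral_sub_left_eq_self _ t]
  refine lintegral_congr fun s => ?_
  have hiff : t - s ∈ Ioo 0 t ↔ s ∈ Ioo 0 t := by
    simp only [mem_Ioo]
    constructor <;> rintro ⟨h1, h2⟩ <;> constructor <;> linarith
  by_cases hs : s ∈ Ioo 0 t
  · rw [indicator_of_mem hs, indicator_of_mem (hiff.2 hs), sub_sub_cancel, mul_comm]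
  · rw [indicator_of_notMem hs, indicator_of_notMem (mt hiff.1 hs)]

/-- The integrated renewal equation, with the lifetime expressed by its survival function. -/
theorem lintegral_killedMean_eq (hm : ∀ t, Measurable (Y t))
    (hc : ∀ ω, Continuous fun t => Y t ω) (hκ : Continuous κ) {a : ℝ} (ha : 0 < a)
    (hle : ∀ x, a ≤ κ x) (hf : Measurable f) (hf1 : ∀ y, f y ≤ 1) (t : ℝ) :
    ∫⁻ s in Ioc 0 t, killedMean P Y κ μ f s.toNNReal =
      ∫⁻ s in Ioc 0 t, killedMean P Y κ μ 1 s.toNNReal *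
        restoreMean P Y κ μ μ f (t - s).toNNReal := by
  have h0 := fun x => ha.le.trans (hle x)
  have hτ' := measurable_arrivalTime hm hc hκ h0
  have hτ : Measurable fun z => (arrivalTime Y κ z).toReal := hτ'.ennreal_toReal
  have hmm := measurable_restoreMean (P := P) μ μ hm hc hκ h0 hf
  have hmr : Measurable fun r : ℝ => restoreMean P Y κ μ μ f r.toNNReal :=
    hmm.comp measurable_real_toNNReal
  have hSr : Measurable fun r : ℝ => killedMean P Y κ μ 1 (t - r).toNNReal :=
    (measurable_killedMean_toNNReal hm hc hκ measurable_one).comp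
      (measurable_const.sub measurable_id)
  have hdead : ∀ z, restoreOccupation P Y κ μ f (t - (arrivalTime Y κ z).toReal) =
      ∫⁻ r in Ioc 0 t, {q : (Ω × ℝ) × ℝ | (arrivalTime Y κ q.1).toReal ≤ t - q.2}.indicator
        (fun q => restoreMean P Y κ μ μ f q.2.toNNReal) (z, r) := fun z => by
    have hset : Ioc 0 (t - (arrivalTime Y κ z).toReal) =
        {r | (arrivalTime Y κ z).toReal ≤ t - r} ∩ Ioc 0 t := by
      ext r
      simp only [mem_Ioc, mem_inter_iff, mem_ofPred_eq]
      have := ENNReal.toReal_nonneg (a := arrivalTime Y κ z)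
      constructor
      · rintro ⟨h1, h2⟩
        refine ⟨?_, h1, ?_⟩ <;> linarith
      · rintro ⟨h1, h2, h3⟩
        refine ⟨h2, ?_⟩
        linarith
    have hms : MeasurableSet {r | (arrivalTime Y κ z).toReal ≤ t - r} :=
      measurableSet_le measurable_const (measurable_const.sub measurable_id)
    rw [restoreOccupation, hset, ← Measure.restrict_restrict hms, ← lintegral_indicator hms]
    rfl
  have hS : MeasurableSet {q : (Ω × ℝ) × ℝ | (arrivalTime Y κ q.1).toReal ≤ t - q.2} :=
    measurableSet_le (hτ.comp measurable_fst) (measurable_const.sub measurable_snd)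
  have hF : Measurable ({q : (Ω × ℝ) × ℝ | (arrivalTime Y κ q.1).toReal ≤ t - q.2}.indicator
      fun q => restoreMean P Y κ μ μ f q.2.toNNReal) :=
    (hmr.comp measurable_snd).indicator hS
  have hdead2 : ∫⁻ z, restoreOccupation P Y κ μ f (t - (arrivalTime Y κ z).toReal)
      ∂(cycleLaw P μ) = ∫⁻ r in Ioc 0 t, restoreMean P Y κ μ μ f r.toNNReal *
        cycleLaw P μ {z | (arrivalTime Y κ z).toReal ≤ t - r} := by
    simp_rw [hdead]
    refine (lintegral_lintegral_swap (f := fun z r => {q : (Ω × ℝ) × ℝ |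
      (arrivalTime Y κ q.1).toReal ≤ t - q.2}.indicator
        (fun q => restoreMean P Y κ μ μ f q.2.toNNReal) (z, r)) hF.aemeasurable).trans ?_
    refine lintegral_congr fun r => ?_
    rw [← lintegral_indicator_const (measurableSet_le hτ measurable_const)]
    rfl
  -- Each $m(r)$ is split according to $\tau\le t-r$ or $\tau>t-r$. The first part is exactly the
  -- regenerated term of the integrated renewal equation and cancels from it.
  have hsplit : restoreOccupation P Y κ μ f t =
      (∫⁻ r in Ioc 0 t, restoreMean P Y κ μ μ f r.toNNReal *
        cycleLaw P μ {z | (arrivalTime Y κ z).toReal ≤ t - r}) +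
      ∫⁻ r in Ioc 0 t, restoreMean P Y κ μ μ f r.toNNReal *
        killedMean P Y κ μ 1 (t - r).toNNReal := by
    have hprod : Measurable fun r : ℝ => restoreMean P Y κ μ μ f r.toNNReal *
        killedMean P Y κ μ 1 (t - r).toNNReal := hmr.mul hSr
    rw [← lintegral_add_right _ hprod]
    refine setLIntegral_congr_fun measurableSet_Ioc fun r hr => ?_
    have hr0 : 0 ≤ t - r := sub_nonneg.2 hr.2
    have hcompl : {z | (arrivalTime Y κ z).toReal ≤ t - r} =
        {z | ((t - r).toNNReal : ℝ≥0∞) < arrivalTime Y κ z}ᶜ := by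
      ext z
      have h := arrivalTime_ne_top hc hκ ha hle z
      simp only [mem_compl_iff, mem_ofPred_eq, not_lt]
      rw [← ENNReal.le_ofReal_iff_toReal_le h hr0]
      rfl
    rw [← mul_add, killedMean, ← cycleLaw_survival P hm hc hκ h0, hcompl, add_comm,
      measure_add_measure_compl (measurable_survival hm hc hκ h0 _), measure_univ, mul_one]
  have h := lintegral_restoreMean (P := P) (μ := μ) μ hm hc hκ ha hle hf t
  rw [hdead2] at h
  change restoreOccupation P Y κ μ f t = _ at h
  -- Cancellation in `ℝ≥0∞` needs a finite term; $f\le1$ bounds it by the window length.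
  have hfin : ∫⁻ r in Ioc 0 t, restoreMean P Y κ μ μ f r.toNNReal *
      cycleLaw P μ {z | (arrivalTime Y κ z).toReal ≤ t - r} ≠ ∞ :=
    ne_top_of_le_ne_top (ENNReal.ofReal_ne_top (r := t))
      ((le_self_add.trans hsplit.ge).trans (restoreOccupation_le hf1 t))
  rw [hsplit, add_comm] at h
  rw [← (ENNReal.add_left_inj hfin).1 h]
  exact lintegral_reflect _ (fun s => killedMean P Y κ μ 1 s.toNNReal) t

/-- Survival supplies the occupation integral over $(t,\infty)$; the integrated renewal equation
shows that regeneration supplies exactly the missing part over $(0,t]$. -/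
theorem IsMarkovFamily.isInvariant_invariantMeasure (hY : IsMarkovFamily P Y)
    (hκ : Continuous κ) {a : ℝ} (ha : 0 < a) (hle : ∀ x, a ≤ κ x) :
    IsInvariant P Y κ μ (invariantMeasure P Y κ μ) := by
  have hm := hY.measurable
  have hc := hY.continuous_paths
  have h0 := fun x => ha.le.trans (hle x)
  have := isProbabilityMeasure_invariantMeasure (P := P) (μ := μ) hm hc hκ ha hle
  refine (isInvariant_iff hm hc hκ h0).2 fun B hB t => ?_
  have hf : Measurable (B.indicator (1 : Euc d → ℝ≥0∞)) := measurable_one.indicator hB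
  have hf1 := indicator_one_le B
  have hunion : Ioi (0 : ℝ) = Ioi (t : ℝ) ∪ Ioc 0 (t : ℝ) := by
    rw [union_comm, Ioc_union_Ioi_eq_Ioi t.coe_nonneg]
  rw [restoreMean_eq μ _ hm hc hκ h0 hf, hY.setLIntegral_cycleLaw_invariantMeasure hκ ha hle
    (measurable_restoreMean μ μ hm hc hκ h0 hf),
    ← lintegral_killedMean_eq hm hc hκ ha hle hf hf1, ← lintegral_indicator_one hB,
    invariantMeasure, lintegral_smul_measure, lintegral_smul_measure,
    hY.lintegral_killed_occupation hκ h0 hf hf1, lintegral_occupation hm hc hκ h0 hf,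
    smul_eq_mul, smul_eq_mul, ← mul_add, hunion, lintegral_union measurableSet_Ioc]
  rw [disjoint_left]
  exact fun s h1 h2 => absurd h2.2 (not_le.2 h1)

end Existence

/-! ### Comparison of the two invariant distributions -/

section Comparison

theorem abs_integral_le {m : Measure (Euc d)} [IsFiniteMeasure m] {f : Euc d → ℝ}
    (hf1 : ∀ x, |f x| ≤ 1) : |∫ x, f x ∂m| ≤ m.real univ := by
  have h := norm_integral_le_of_norm_le_const (μ := m) (f := f) (C := 1) (ae_of_all _ hf1)
  simpa using h

/-- With $E=H-G$ of mass $\delta$ and $G$ of mass $c$, the normalised integrals differ by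
$(cE(f)-\delta G(f))/((\delta+c)c)$. Both numerator terms are at most $\delta c$, which gives
$2\delta/(\delta+c)\le 2\delta/c$. -/
theorem tvNorm_normalize_le {G H : Measure (Euc d)} [IsFiniteMeasure G] [IsFiniteMeasure H]
    (hle : G ≤ H) (h0 : G univ ≠ 0) :
    tvNorm ((H univ)⁻¹ • H) ((G univ)⁻¹ • G) ≤ 2 * (H univ - G univ) / G univ := by
  refine iSup_le fun f => iSup_le fun hf => iSup_le fun hf1 => ?_
  set E := H - G with hE
  have hH : H = E + G := (Measure.sub_add_cancel_of_le hle).symm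
  have hEu : H univ - G univ = E univ := by
    rw [hH, Measure.add_apply, ENNReal.add_sub_cancel_right (measure_ne_top G univ)]
  have hint : ∀ m : Measure (Euc d), IsFiniteMeasure m → Integrable f m := fun m _ =>
    Integrable.of_bound hf.aestronglyMeasurable 1 (ae_of_all _ hf1)
  have hfE : IsFiniteMeasure E := isFiniteMeasure_of_le H Measure.sub_le
  have hc : 0 < G.real univ := ENNReal.toReal_pos h0 (measure_ne_top _ _)
  have hδ : 0 ≤ E.real univ := measureReal_nonneg
  have hHr : H.real univ = E.real univ + G.real univ := by
    rw [hH, measureReal_add_apply]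
  have hg := abs_integral_le (m := G) hf1
  have he := abs_integral_le (m := E) hf1
  rw [integral_smul_measure, integral_smul_measure, ENNReal.toReal_inv, ENNReal.toReal_inv]
  change ENNReal.ofReal |(H.real univ)⁻¹ • _ - (G.real univ)⁻¹ • _| ≤ _
  rw [hHr, hEu]
  conv_lhs => rw [hH]
  rw [integral_add_measure (hint E hfE) (hint G inferInstance)]
  have hbound : |(E.real univ + G.real univ)⁻¹ • ((∫ x, f x ∂E) + ∫ x, f x ∂G) -
      (G.real univ)⁻¹ • ∫ x, f x ∂G| ≤ 2 * E.real univ / G.real univ := by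
    set c := G.real univ
    set δ := E.real univ
    set e := ∫ x, f x ∂E
    set g := ∫ x, f x ∂G
    have hne : δ + c ≠ 0 := by positivity
    have h1 : (δ + c)⁻¹ • (e + g) - c⁻¹ • g = (e * c - g * δ) / ((δ + c) * c) := by
      simp only [smul_eq_mul]
      field_simp
      ring
    rw [h1, abs_div, abs_of_pos (show 0 < (δ + c) * c by positivity),
      div_le_div_iff₀ (by positivity) hc]
    have h2 : |e * c - g * δ| ≤ 2 * δ * c := by
      refine (abs_sub _ _).trans ?_
      rw [abs_mul, abs_mul, abs_of_pos hc, abs_of_nonneg hδ]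
      nlinarith
    have h3 : 2 * δ * c * c ≤ 2 * δ * ((δ + c) * c) := by
      have : 0 ≤ δ * δ * c := by positivity
      nlinarith
    exact (mul_le_mul_of_nonneg_right h2 hc.le).trans h3
  refine (ENNReal.ofReal_le_ofReal hbound).trans_eq ?_
  rw [ENNReal.ofReal_div_of_pos hc, ENNReal.ofReal_mul zero_le_two, ofReal_measureReal,
    ofReal_measureReal, ENNReal.ofReal_ofNat]

theorem cumRate_eq_add_sub {Y : ℝ≥0 → Ω → Euc d} {κ κ' : Euc d → ℝ}
    (hc : ∀ ω, Continuous fun t => Y t ω) (hκ : Continuous κ) (hκ' : Continuous κ') (t : ℝ≥0)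
    (ω : Ω) : cumRate Y κ t ω = cumRate Y κ' t ω + cumRate Y (fun x => κ x - κ' x) t ω := by
  have hsub : Continuous fun x => κ x - κ' x := hκ.sub hκ'
  rw [← cumRate_add hc hκ' hsub]
  simp only [add_sub_cancel]

variable [MeasurableSpace Ω] {P : Kernel (Euc d) Ω} {Y : ℝ≥0 → Ω → Euc d}
  {κ κ' : Euc d → ℝ} {μ : Measure (Euc d)}

theorem cycleLaw_arrivalTime_le (hm : ∀ t, Measurable (Y t))
    (hc : ∀ ω, Continuous fun t => Y t ω) (hκ : Continuous κ) (h0 : ∀ x, 0 ≤ κ x) (t : ℝ≥0)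
    (ν : Measure (Euc d)) :
    cycleLaw P ν {z | arrivalTime Y κ z ≤ t} =
      ∫⁻ x, ∫⁻ ω, ENNReal.ofReal (1 - Real.exp (-cumRate Y κ t ω)) ∂(P x) ∂ν := by
  have hS : MeasurableSet {z | arrivalTime Y κ z ≤ t} :=
    measurableSet_le (measurable_arrivalTime hm hc hκ h0) measurable_const
  rw [← lintegral_indicator_one hS, lintegral_cycleLaw P ν (measurable_one.indicator hS)]
  refine lintegral_congr fun x => lintegral_congr fun ω => ?_
  rw [← expMeasure_one_Iic (cumRate_nonneg h0 t ω), ← lintegral_indicator_one measurableSet_Iic]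
  refine lintegral_congr fun ξ => ?_
  simp only [indicator, mem_ofPred_eq, arrivalTime_le_iff hc hκ h0, mem_Iic]
  rfl

variable [IsMarkovKernel P] [IsProbabilityMeasure μ]

theorem occupation_mono (hm : ∀ t, Measurable (Y t)) (hc : ∀ ω, Continuous fun t => Y t ω)
    (hκ : Continuous κ) (hκ' : Continuous κ') (h0 : ∀ x, 0 ≤ κ' x) (hle : ∀ x, κ' x ≤ κ x) :
    occupation P Y κ μ ≤ occupation P Y κ' μ := by
  refine Measure.le_iff.2 fun B hB => ?_
  rw [← lintegral_indicator_one hB, ← lintegral_indicator_one hB,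
    lintegral_occupation hm hc hκ (fun x => (h0 x).trans (hle x)) (measurable_one.indicator hB),
    lintegral_occupation hm hc hκ' h0 (measurable_one.indicator hB)]
  refine lintegral_mono fun s => lintegral_mono fun x => lintegral_mono fun ω => ?_
  gcongr
  have := cumRate_eq_add_sub (Y := Y) hc hκ hκ' s.toNNReal ω
  have h2 : 0 ≤ cumRate Y (fun x => κ x - κ' x) s.toNNReal ω :=
    cumRate_nonneg (fun x => sub_nonneg.2 (hle x)) _ _
  linarith

/-- Write $K,K'$ for the accumulated rates of $\kappa,\kappa'$ and $D=K-K'$. Then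
$e^{-K'}=e^{-K}+e^{-K'}(1-e^{-D})$ and $e^{-K'}\le e^{-sa}$, while the mean of $1-e^{-D}$ is the
probability that the excess clock rings by time $s$. -/
theorem lintegral_arrivalTime_le_add (hm : ∀ t, Measurable (Y t))
    (hc : ∀ ω, Continuous fun t => Y t ω) (hκ : Continuous κ) (hκ' : Continuous κ') {a : ℝ}
    (ha : 0 < a) (hle' : ∀ x, a ≤ κ' x) (hle : ∀ x, κ' x ≤ κ x) :
    ∫⁻ z, arrivalTime Y κ' z ∂(cycleLaw P μ) ≤
      ∫⁻ z, arrivalTime Y κ z ∂(cycleLaw P μ) + ∫⁻ t in Ioi (0 : ℝ),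
        cycleLaw P μ {z | arrivalTime Y (fun x => κ x - κ' x) z ≤ ENNReal.ofReal t} *
          ENNReal.ofReal (Real.exp (-t * a)) := by
  have h0' := fun x => ha.le.trans (hle' x)
  have h0 := fun x => (h0' x).trans (hle x)
  have he := fun x => sub_nonneg.2 (hle x)
  have hsub : Continuous fun x => κ x - κ' x := hκ.sub hκ'
  rw [← lintegral_killedMean_one hm hc hκ' h0', ← lintegral_killedMean_one hm hc hκ h0,
    ← lintegral_add_left (measurable_killedMean_toNNReal hm hc hκ measurable_one)]
  refine setLIntegral_mono' measurableSet_Ioi fun s hs => ?_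
  have hcyc := cycleLaw_arrivalTime_le (P := P) hm hc hsub he s.toNNReal μ
  rw [show (ENNReal.ofReal s : ℝ≥0∞) = s.toNNReal from rfl, hcyc]
  have hmk : Measurable fun ω =>
      ENNReal.ofReal (Real.exp (-cumRate Y κ s.toNNReal ω)) * (1 : Euc d → ℝ≥0∞) (Y s.toNNReal ω) :=
    ((measurable_cumRate hm hc hκ _).neg.exp.ennreal_ofReal).mul measurable_const
  have hmr : Measurable fun ω =>
      ENNReal.ofReal (1 - Real.exp (-cumRate Y (fun x => κ x - κ' x) s.toNNReal ω)) :=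
    (measurable_const.sub (measurable_cumRate hm hc hsub _).neg.exp).ennreal_ofReal
  rw [← lintegral_mul_const _ hmr.lintegral_kernel, killedMean,
    killedMean, ← lintegral_add_left (measurable_killed P hm hc hκ measurable_one _)]
  refine lintegral_mono fun x => ?_
  rw [← lintegral_mul_const _ hmr, killed, killed, ← lintegral_add_left hmk]
  refine lintegral_mono fun ω => ?_
  simp only [Pi.one_apply, mul_one]
  have hadd := cumRate_eq_add_sub (Y := Y) hc hκ hκ' s.toNNReal ω
  have hlow := mul_le_cumRate (Y := Y) hc hκ' hle' s.toNNReal ω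
  rw [Real.coe_toNNReal s (le_of_lt hs)] at hlow
  have hb : 0 ≤ cumRate Y (fun x => κ x - κ' x) s.toNNReal ω := cumRate_nonneg he _ _
  have h1 : Real.exp (-cumRate Y (fun x => κ x - κ' x) s.toNNReal ω) ≤ 1 :=
    Real.exp_le_one_iff.2 (neg_nonpos.2 hb)
  rw [← ENNReal.ofReal_mul (sub_nonneg.2 h1),
    ← ENNReal.ofReal_add (Real.exp_pos _).le (mul_nonneg (sub_nonneg.2 h1) (Real.exp_pos _).le)]
  refine ENNReal.ofReal_le_ofReal ?_
  have h2 : Real.exp (-cumRate Y κ' s.toNNReal ω) ≤ Real.exp (-s * a) :=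
    Real.exp_le_exp.2 (by linarith)
  rw [hadd, neg_add, Real.exp_add]
  nlinarith [mul_le_mul_of_nonneg_left h2 (sub_nonneg.2 h1)]

theorem tvNorm_invariantMeasure_le (hm : ∀ t, Measurable (Y t))
    (hc : ∀ ω, Continuous fun t => Y t ω) (hκ : Continuous κ) (hκ' : Continuous κ') {a : ℝ}
    (ha : 0 < a) (hle' : ∀ x, a ≤ κ' x) (hle : ∀ x, κ' x ≤ κ x) :
    tvNorm (invariantMeasure P Y κ' μ) (invariantMeasure P Y κ μ) ≤
      2 * (∫⁻ t in Ioi (0 : ℝ),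
        cycleLaw P μ {z | arrivalTime Y (fun x => κ x - κ' x) z ≤ ENNReal.ofReal t} *
          ENNReal.ofReal (Real.exp (-t * a))) / ∫⁻ z, arrivalTime Y κ z ∂(cycleLaw P μ) := by
  have h0' := fun x => ha.le.trans (hle' x)
  have h0 := fun x => (h0' x).trans (hle x)
  have hu := occupation_univ (P := P) (ν := μ) hm hc hκ h0
  have hu' := occupation_univ (P := P) (ν := μ) hm hc hκ' h0'
  have hfin : IsFiniteMeasure (occupation P Y κ μ) := ⟨by
    rw [hu]
    exact (lintegral_arrivalTime_ne_top hm hc hκ ha fun x => (hle' x).trans (hle x)).lt_top⟩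
  have hfin' : IsFiniteMeasure (occupation P Y κ' μ) := ⟨by
    rw [hu']
    exact (lintegral_arrivalTime_ne_top hm hc hκ' ha hle').lt_top⟩
  have h := tvNorm_normalize_le (occupation_mono (P := P) (μ := μ) hm hc hκ hκ' h0' hle)
    (by rw [hu]; exact lintegral_arrivalTime_ne_zero hm hc hκ h0)
  rw [hu, hu'] at h
  refine h.trans ?_
  gcongr
  exact tsub_le_iff_left.2 (lintegral_arrivalTime_le_add hm hc hκ hκ' ha hle' hle)

end Comparison

/-! ### Assembly -/

theorem forall_le_of_ae_refMeasure {A : Euc d → ℝ} (hA : Continuous A) {κ : Euc d → ℝ}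
    (hκ : Continuous κ) {a : ℝ} (h : ∀ᵐ x ∂(refMeasure A), a ≤ κ x) (x : Euc d) : a ≤ κ x := by
  have hmeas : Measurable fun y => ENNReal.ofReal (Real.exp (2 * A y)) :=
    (hA.measurable.const_mul 2).exp.ennreal_ofReal
  rw [refMeasure, ae_withDensity_iff hmeas] at h
  have h2 : volume {x | κ x < a} = 0 := by
    rw [measure_eq_zero_iff_ae_notMem]
    filter_upwards [h] with y hy
    simpa using hy (ENNReal.ofReal_pos.2 (Real.exp_pos _)).ne'
  -- The density of $\Gamma$ is positive, so the exceptional set is Lebesgue-null; being open, it is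
  -- empty.
  have h3 := (isOpen_lt hκ continuous_const).eq_empty_of_measure_zero h2
  by_contra! hlt
  exact (h3 ▸ (show x ∈ {x | κ x < a} from hlt) : x ∈ (∅ : Set (Euc d)))

theorem IsMarkovFamily.existsUnique_isInvariant [MeasurableSpace Ω] {P : Kernel (Euc d) Ω}
    [IsMarkovKernel P] {Y : ℝ≥0 → Ω → Euc d} (hY : IsMarkovFamily P Y) {κ : Euc d → ℝ}
    (hκ : Continuous κ) {a : ℝ} (ha : 0 < a) (hle : ∀ x, a ≤ κ x) (μ : Measure (Euc d))
    [IsProbabilityMeasure μ] : ∃! π : ProbabilityMeasure (Euc d), IsInvariant P Y κ μ π := by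
  refine ⟨⟨invariantMeasure P Y κ μ, isProbabilityMeasure_invariantMeasure hY.measurable
    hY.continuous_paths hκ ha hle⟩, hY.isInvariant_invariantMeasure hκ ha hle, fun π hπ => ?_⟩
  have := isProbabilityMeasure_invariantMeasure (P := P) (μ := μ) hY.measurable
    hY.continuous_paths hκ ha hle
  exact Subtype.ext (hπ.eq hY.measurable hY.continuous_paths hκ ha hle
    (hY.isInvariant_invariantMeasure hκ ha hle))

end Restore

theorem mainTheorem6 {d : ℕ} {Ω : Type*} [MeasurableSpace Ω]
    (A : Restore.Euc d → ℝ) (p : ℝ → Restore.Euc d → Restore.Euc d → ℝ)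
    (P : Kernel (Restore.Euc d) Ω) [IsMarkovKernel P] (Y : ℝ≥0 → Ω → Restore.Euc d)
    (hY : Restore.IsBASSADiffusion A p P Y)
    (μ : Measure (Restore.Euc d)) [IsProbabilityMeasure μ]
    (κ : Restore.Euc d → ℝ) (hκ : Continuous κ)
    (κlow : ℝ) (hκlow : 0 < κlow) (hκ_ge : ∀ᵐ x ∂(Restore.refMeasure A), κlow ≤ κ x)
    (M : ℝ) (hM : (⨅ x, κ x) < M) :
    (∃! π : ProbabilityMeasure (Restore.Euc d), Restore.IsInvariant P Y κ μ π) ∧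
    (∃! πM : ProbabilityMeasure (Restore.Euc d),
      Restore.IsInvariant P Y (Restore.truncRate κ M) μ πM) ∧
    ∀ π πM : ProbabilityMeasure (Restore.Euc d),
      Restore.IsInvariant P Y κ μ π →
      Restore.IsInvariant P Y (Restore.truncRate κ M) μ πM →
      Restore.tvNorm (πM : Measure (Restore.Euc d)) π ≤
        4 * (∫⁻ t in Ioi (0 : ℝ),
            Restore.cycleLaw P μ
                {z | Restore.arrivalTime Y (Restore.excessRate κ M) z ≤ ENNReal.ofReal t} *
              ENNReal.ofReal (Real.exp (-t * κlow))) /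
          ∫⁻ z, Restore.arrivalTime Y κ z ∂(Restore.cycleLaw P μ) := by
  have hMY := hY.isMarkovFamily
  have hm := hMY.measurable
  have hc := hMY.continuous_paths
  have hle := Restore.forall_le_of_ae_refMeasure hY.smooth.continuous hκ hκ_ge
  -- Truncation keeps the lower bound because $M>\inf\kappa\ge\underline\kappa$.
  have hleM : ∀ x, κlow ≤ Restore.truncRate κ M x := fun x =>
    le_min (hle x) ((le_ciInf hle).trans hM.le)
  have hκM : Continuous (Restore.truncRate κ M) := hκ.min continuous_const
  refine ⟨hMY.existsUnique_isInvariant hκ hκlow hle μ,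
    hMY.existsUnique_isInvariant hκM hκlow hleM μ, fun π πM hπ hπM => ?_⟩
  have := Restore.isProbabilityMeasure_invariantMeasure (P := P) (μ := μ) hm hc hκ hκlow hle
  have := Restore.isProbabilityMeasure_invariantMeasure (P := P) (μ := μ) hm hc hκM hκlow hleM
  -- By uniqueness, arbitrary invariant laws are replaced by the explicit normalised occupation
  -- measures.
  rw [hπ.eq hm hc hκ hκlow hle (hMY.isInvariant_invariantMeasure hκ hκlow hle),
    hπM.eq hm hc hκM hκlow hleM (hMY.isInvariant_invariantMeasure hκM hκlow hleM)]
  refine (Restore.tvNorm_invariantMeasure_le hm hc hκ hκM hκlow hleM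
    fun x => min_le_left _ _).trans ?_
  -- Only the constant is weakened, from 2 to 4.
  gcongr
  · norm_num
  · exact le_rfl
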